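/- Let $\rho,\alpha,h$ be real with $0<\rho<1$. Consider the Lamé equation in the variable $\xi=\mathrm{sn}^2(\cdot,\rho)$, $$y''+\frac12\Big(\frac1\xi+\frac1{\xi-1}+\frac1{\xi-\rho^{-2}}\Big)y'+\frac{-\alpha(\alpha+1)\xi+h\rho^{-2}}{4\xi(\xi-1)(\xi-\rho^{-2})}\,y=0 ,\qquad(\ast)$$ and let $LF(\xi)=\sum_{n\ge0}c_n\xi^n$ be its Frobenius series at $\xi=0$ with exponent $0$ and $c_0=1$, that is $c_1=-h/2$ and $$c_{n+2}=\frac{\big(4(1+\rho^2)(n+1)^2-h\big)c_{n+1}-\rho^2(2n-\alpha)(2n+1+\alpha)c_n}{2(n+2)(2n+3)}\quad(n\ge0).$$ Put $\Delta_k^{\pm}=2k\pm\sqrt{h/(4(1+\rho^2))}$ (complex square root), $\eta=(1+\rho^2)\xi$ and $z=-\rho^2\xi^2$. Define functions $I_0,I_1,I_2,\dots$ on the unit disc $|x|<1$ by $I_0(x)={}_2F_1(\Delta_0^-,\Delta_0^+;\tfrac12;x)$ and, for $k\ge1$, $$I_k(x)=\int_0^1\!dt\,t^{2k-1}\int_0^1\!du\,u^{2k-\frac32}\,\frac1{2\pi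 i}\oint\frac{dv}{v}\Big(\frac{v-1}{v}\Big)^{-\Delta_k^-}\big(1-x(1-t)(1-u)v\big)^{-\Delta_k^+}\,(D_kI_{k-1})(w),$$ $$w=\frac{v}{v-1}\,\frac{x\,t\,u}{1-x\,v(1-t)(1-u)},\qquad D_k=w^{-(2k-\frac32+\frac\alpha2)}\,(w\partial_w)\,w^{\alpha+\frac12}\,(w\partial_w)\,w^{2k-2-\frac\alpha2},$$ where the powers of $(v-1)/v$ and of $1-x(1-t)(1-u)v$ are principal, and the powers of $w$ in $D_k$ are taken along any one local branch. The contour is a positively oriented circle $|v|=R$, where $R=R_k(x,t,u)$ is admissible, i.e. for $|x|<1$ and $0<t,u<1$: $R>1$, $|x|(1-t)(1-u)R<1$, and $|w|<1$ on the circle. Then: 1. $LF$ is holomorphic on $|\xi|<1$, $LF(0)=1$, and $LF$ satisfies $(\ast)$ for $0<|\xi|<1$. 2. Admissible radii $R_k(x,t,u)$ exist. 3. For every admissible choice of radii, each $I_k$ is holomorphic on $0<|x|<1$; for $k\ge1$ and $0<|x|<1$, the integrands of the integrals in $v$ (for all $0<t,u<1$), in $u$ (for all $0<t<1$) and in $t$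 that define $I_k(x)$ are integrable; and for every $\xi\in\mathbb C$ with $(1+\rho^2)|\xi|+\rho^2|\xi|^2<1$, $$LF(\xi)={}_2F_1\big(\Delta_0^-,\Delta_0^+;\tfrac12;\eta\big)+\sum_{n=1}^\infty I_n(\eta)\,z^n ,$$ the series being (unconditionally) convergent. -/

import Mathlib

noncomputable section

namespace Lame

/-- Coefficients `c 0 = 1, c 1, c 2, …` of the Frobenius series with exponent `0` at `ξ = 0` of the
Lamé equation in the variable `ξ = sn²`. -/
def coeff (ρ α h : ℝ) : ℕ → ℝ
  | 0 => 1
  | 1 => -h / 2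
  | n + 2 =>
      ((4 * (1 + ρ ^ 2) * ((n : ℝ) + 1) ^ 2 - h) * coeff ρ α h (n + 1)
          - ρ ^ 2 * (2 * n - α) * (2 * n + 1 + α) * coeff ρ α h n)
        / (2 * ((n : ℝ) + 2) * (2 * n + 3))

/-- The solution of the first kind about `ξ = 0` (exponent `0`, normalized by `c 0 = 1`). -/
def LF (ρ α h : ℝ) (ξ : ℂ) : ℂ := ∑' n : ℕ, (coeff ρ α h n : ℂ) * ξ ^ n

/-- `y` satisfies the Lamé equation, in the variable `ξ = sn²`, at the point `ξ`. -/
def EquationAt (ρ α h : ℝ) (y : ℂ → ℂ) (ξ : ℂ) : Prop :=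
  deriv (deriv y) ξ
    + 1 / 2 * (1 / ξ + 1 / (ξ - 1) + 1 / (ξ - ((ρ : ℂ) ^ 2)⁻¹)) * deriv y ξ
    + (-(α : ℂ) * (α + 1) * ξ + h * ((ρ : ℂ) ^ 2)⁻¹)
        / (4 * ξ * (ξ - 1) * (ξ - ((ρ : ℂ) ^ 2)⁻¹)) * y ξ = 0

/-- The complex square root of `h / (4 (1 + ρ²))`. -/
def sigma (ρ h : ℝ) : ℂ := ((h / (4 * (1 + ρ ^ 2)) : ℝ) : ℂ) ^ (1 / 2 : ℂ)

/-- `Δ_k⁻`. -/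
def deltaMinus (ρ h : ℝ) (k : ℕ) : ℂ := 2 * k - sigma ρ h

/-- `Δ_k⁺`. -/
def deltaPlus (ρ h : ℝ) (k : ℕ) : ℂ := 2 * k + sigma ρ h

/-- The power `w ^ p` along the branch that is holomorphic near `w₀` and agrees with the principal
branch at `w₀` (for `w₀ ≠ 0`). -/
def powNear (w₀ p w : ℂ) : ℂ := Complex.exp (p * (Complex.log w₀ + Complex.log (w / w₀)))

/-- The operator `w ^ (-(2k - 3/2 + α/2)) (w ∂_w) w ^ (α + 1/2) (w ∂_w) w ^ (2k - 2 - α/2)` applied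
to `f`, at the point `w₀`. All powers use one branch that is holomorphic near `w₀`; since the three
exponents add up to `0`, the result does not depend on it. -/
def eulerOp (α : ℝ) (k : ℕ) (f : ℂ → ℂ) (w₀ : ℂ) : ℂ :=
  powNear w₀ (-(2 * k - 3 / 2 + α / 2)) w₀ *
    (w₀ * deriv (fun w₁ =>
      powNear w₀ (α + 1 / 2) w₁ *
        (w₁ * deriv (fun w₂ => powNear w₀ (2 * k - 2 - α / 2) w₂ * f w₂) w₁)) w₀)

/-- `w = v / (v - 1) * (x t u / (1 - x v (1 - t) (1 - u)))`. -/
def innerVar (x : ℂ) (t u : ℝ) (v : ℂ) : ℂ :=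
  v / (v - 1) * (x * t * u / (1 - x * v * (1 - t) * (1 - u)))

/-- The integrand of the contour integral in `v` at level `k`. -/
def contourIntegrand (ρ α h : ℝ) (k : ℕ) (f : ℂ → ℂ) (x : ℂ) (t u : ℝ) (v : ℂ) : ℂ :=
  1 / v * ((v - 1) / v) ^ (-deltaMinus ρ h k)
    * (1 - x * (1 - t) * (1 - u) * v) ^ (-deltaPlus ρ h k)
    * eulerOp α k f (innerVar x t u v)

/-- The integrand of the `u`-integral at level `k`: `u ^ (2k - 3/2)` times the normalized contour
integral, taken over the circle `|v| = r x t u`. -/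
def uIntegrand (ρ α h : ℝ) (k : ℕ) (r : ℂ → ℝ → ℝ → ℝ) (f : ℂ → ℂ) (x : ℂ) (t u : ℝ) : ℂ :=
  ((u ^ (2 * (k : ℝ) - 3 / 2) : ℝ) : ℂ) *
    (1 / (2 * Real.pi * Complex.I) *
      ∮ v in C(0, r x t u), contourIntegrand ρ α h k f x t u v)

/-- The integrand of the `t`-integral at level `k`. -/
def tIntegrand (ρ α h : ℝ) (k : ℕ) (r : ℂ → ℝ → ℝ → ℝ) (f : ℂ → ℂ) (x : ℂ) (t : ℝ) : ℂ :=
  ((t ^ (2 * (k : ℝ) - 1) : ℝ) : ℂ) * ∫ u in (0 : ℝ)..1, uIntegrand ρ α h k r f x t u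

/-- The `n`-fold nested integral as a function of the outermost variable `x = w_{n+1,n}`; level `n`
is the outermost one, and level `0` is the function `₂F₁(Δ₀⁻, Δ₀⁺; 1/2; ·)`. -/
def nestedIntegral (ρ α h : ℝ) (r : ℕ → ℂ → ℝ → ℝ → ℝ) : ℕ → ℂ → ℂ
  | 0 => fun x => ordinaryHypergeometric (deltaMinus ρ h 0) (deltaPlus ρ h 0) (1 / 2 : ℂ) x
  | n + 1 => fun x =>
      ∫ t in (0 : ℝ)..1, tIntegrand ρ α h (n + 1) (r (n + 1)) (nestedIntegral ρ α h r n) x t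

/-- The circles `|v| = r k x t u` are admissible contours: they enclose `0` and `1`, they do not
enclose (or meet) the pole `v = 1 / (x (1 - t) (1 - u))`, and on them the inner variable stays in
the open unit disc, where the next function in the nest is defined. -/
def AdmissibleRadii (r : ℕ → ℂ → ℝ → ℝ → ℝ) : Prop :=
  ∀ (k : ℕ) (x : ℂ) (t u : ℝ), ‖x‖ < 1 → t ∈ Set.Ioo (0 : ℝ) 1 → u ∈ Set.Ioo (0 : ℝ) 1 →
    1 < r k x t u ∧ ‖x‖ * (1 - t) * (1 - u) * r k x t u < 1 ∧
      ∀ v : ℂ, ‖v‖ = r k x t u → ‖innerVar x t u v‖ < 1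

end Lame

end

/-! With `θ = ξ d/dξ`, `σ = sigma ρ h` and `(1 + ρ²) σ² = h/4`, the Lamé equation reads `θ(θ - 1/2)
y = (1 + ρ²) ξ (θ² - σ²) y - ρ² ξ² (θ - α/2)(θ + 1/2 + α/2) y`. Without the last term it is the
hypergeometric equation in `η`. The last term is treated as a perturbation: the coefficient of `ξ ^
N` in `LF` splits into levels, level `k` collecting what has passed through the last term exactly
`k` times. Level `k` has the form `z ^ k` times a power series in `η`, with coefficients `nestCoeff
k`. Each level solves the hypergeometric recurrence with the previous level as source
(`levelCoeff_succ_recurrence`), and the levels add up to `LF` (`sum_levelCoeff`).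

Solving for one level is a convolution: a source at index `m`, carried on by `p` steps, is
multiplied by `kern m p`, a quotient of rising factorials. The triple integral realises this. The
operator `D_k` multiplies `w ^ m` by `eulerFactor` (`eulerOp_eq_psum`). The contour integral
extracts the constant term of a product of two binomial series and gives the numerator of `kern`
over `p!²` (`circleIntegral_psum`). The `u`- and `t`-integrals are Beta integrals, each replacing
one `p!` by a rising factorial (`double_integral_contourTerm`). Hence `I_k` has Taylor coefficients
`nestCoeff k` (`nestedIntegral_eq_psum`).

Two estimates justify the interchanges. Inside one level, the double series has a majorant that is
geometric in `p` and leaves only the singularity `u ^ (-1/2)` (`norm_contourCoeff_mul_le`). Across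
levels, the sums of norms obey a two-step inequality whose limiting coefficients are `(1 + ρ²)|ξ|`
and `ρ²|ξ|²`; a sum below `1` gives absolute convergence (`summable_levelNorm`). -/

open Filter Topology MeasureTheory

namespace Lame

/-! ### Power series on the unit disc -/

/-- The sum of the power series with coefficients `a`. -/
noncomputable def psum (a : ℕ → ℂ) (x : ℂ) : ℂ := ∑' n, a n * x ^ n

/-- The power series with coefficients `a` converges on the open unit disc. -/
def Conv (a : ℕ → ℂ) : Prop := ∀ x : ℂ, ‖x‖ < 1 → Summable fun n => a n * x ^ n

lemma Conv.hasSum {a : ℕ → ℂ} (h : Conv a) {x : ℂ} (hx : ‖x‖ < 1) :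
    HasSum (fun n => a n * x ^ n) (psum a x) := (h x hx).hasSum

lemma Conv.summable_norm {a : ℕ → ℂ} (h : Conv a) {r : ℝ} (hr0 : 0 ≤ r) (hr : r < 1) :
    Summable fun n => ‖a n‖ * r ^ n := by
  have := (h r (by simpa [abs_of_nonneg hr0] using hr)).norm
  simpa [abs_of_nonneg hr0] using this

lemma Conv.natCast_mul {a : ℕ → ℂ} (h : Conv a) : Conv fun n => (n : ℂ) * a n := by
  intro x hx
  obtain ⟨r, hxr, hr⟩ := exists_between hx
  have hr0 : 0 < r := (norm_nonneg x).trans_lt hxr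
  refine .of_norm_bounded_eventually_nat (h.summable_norm hr0.le hr) ?_
  have hq : ‖x‖ / r < 1 := by rwa [div_lt_one hr0]
  have ht := tendsto_self_mul_const_pow_of_lt_one (by positivity : 0 ≤ ‖x‖ / r) hq
  filter_upwards [ht.eventually (gt_mem_nhds one_pos)] with n hn
  rw [div_pow, ← mul_div_assoc, div_lt_one (by positivity)] at hn
  simp only [norm_mul, norm_pow, Complex.norm_natCast]
  calc n * ‖a n‖ * ‖x‖ ^ n = ‖a n‖ * (n * ‖x‖ ^ n) := by ring
    _ ≤ _ := by gcongr

lemma Conv.add_mul {a : ℕ → ℂ} (h : Conv a) (p : ℂ) : Conv fun n => ((n : ℂ) + p) * a n := by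
  intro x hx
  refine ((h.natCast_mul x hx).add ((h x hx).mul_left p)).congr fun n => ?_
  ring

lemma psum_differentiableOn {a : ℕ → ℂ} (h : Conv a) :
    DifferentiableOn ℂ (psum a) (Metric.ball 0 1) := by
  intro x hx
  rw [mem_ball_zero_iff] at hx
  obtain ⟨r, hxr, hr⟩ := exists_between hx
  have hr0 : 0 < r := (norm_nonneg x).trans_lt hxr
  have := Complex.differentiableOn_tsum_of_summable_norm (F := fun n x => a n * x ^ n)
    (U := Metric.ball 0 r) (h.summable_norm hr0.le hr) (fun i => by fun_prop) Metric.isOpen_ball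
    (fun i w hw => by
      rw [mem_ball_zero_iff] at hw
      rw [norm_mul, norm_pow]
      gcongr)
  exact (this.differentiableAt (Metric.isOpen_ball.mem_nhds
    (by simpa using hxr))).differentiableWithinAt

lemma psum_differentiableAt {a : ℕ → ℂ} (h : Conv a) {x : ℂ} (hx : ‖x‖ < 1) :
    DifferentiableAt ℂ (psum a) x :=
  (psum_differentiableOn h).differentiableAt (Metric.isOpen_ball.mem_nhds (by simpa using hx))

lemma mul_deriv_psum {a : ℕ → ℂ} (h : Conv a) {x : ℂ} (hx : ‖x‖ < 1) :
    x * deriv (psum a) x = psum (fun n => (n : ℂ) * a n) x := by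
  obtain ⟨r, hxr, hr⟩ := exists_between hx
  have hr0 : 0 < r := (norm_nonneg x).trans_lt hxr
  have := Complex.hasSum_deriv_of_summable_norm (F := fun n x => a n * x ^ n)
    (U := Metric.ball 0 r) (z := x) (h.summable_norm hr0.le hr) (fun i => by fun_prop)
    Metric.isOpen_ball
    (fun i w hw => by
      rw [mem_ball_zero_iff] at hw
      rw [norm_mul, norm_pow]
      gcongr) (by simpa using hxr)
  refine ((this.mul_left x).tsum_eq).symm.trans (tsum_congr fun n => ?_)
  rcases n with _ | n
  · simp
  · simp only [deriv_const_mul_field', deriv_pow_field]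
    simp
    ring

lemma psum_natCast_add_mul {a : ℕ → ℂ} (h : Conv a) (p : ℂ) {x : ℂ} (hx : ‖x‖ < 1) :
    psum (fun n => ((n : ℂ) + p) * a n) x = p * psum a x + x * deriv (psum a) x := by
  rw [mul_deriv_psum h hx]
  refine (((h.hasSum hx).mul_left p).add (h.natCast_mul.hasSum hx)).tsum_eq ▸ ?_
  exact tsum_congr fun n => by ring

/-- Translates a three-term recurrence into an identity of functions; `h0` and `h1` are its
instances at `n = -2` and `n = -1`, with coefficients of negative index read as `0`. -/
lemma psum_eq_of_recurrence {d e f : ℕ → ℂ} {x : ℂ} (hx : ‖x‖ < 1) (hd : Conv d) (he : Conv e)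
    (hf : Conv f) (h0 : d 0 = 0) (h1 : d 1 = e 0) (h2 : ∀ n, d (n + 2) = e (n + 1) + f n) :
    psum d x = x * psum e x + x ^ 2 * psum f x := by
  have hd' := (hasSum_nat_add_iff' 2).mpr (hd.hasSum hx)
  have he' := ((hasSum_nat_add_iff' 1).mpr (he.hasSum hx)).mul_left x
  have hf' := (hf.hasSum hx).mul_left (x ^ 2)
  have := hd'.unique ((he'.add hf').congr_fun fun n => ?_)
  · simp [Finset.sum_range_succ, h0, h1] at this
    linear_combination this
  · simp only [h2]; ring

/-! ### The Euler operator on power series -/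

/-- Multiplying by `w ^ p`, applying `w ∂_w` and removing the power again adds `p` to `w ∂_w`. -/
lemma mul_deriv_powNear_mul {w₀ w p : ℂ} (hw : w / w₀ ∈ Complex.slitPlane) (hw0 : w₀ ≠ 0)
    {g : ℂ → ℂ} (hg : DifferentiableAt ℂ g w) :
    w * deriv (fun z => powNear w₀ p z * g z) w = powNear w₀ p w * (p * g w + w * deriv g w) := by
  have hne : w ≠ 0 := by
    rintro rfl
    simp at hw
  have h1 : HasDerivAt (fun z => powNear w₀ p z) (powNear w₀ p w * (p * (w⁻¹))) w := by
    unfold powNear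
    have := ((((hasDerivAt_id w).div_const w₀).clog hw).const_add (Complex.log w₀)).const_mul p
    refine this.cexp.congr_deriv ?_
    simp only [id]
    field_simp
  rw [(h1.fun_mul hg.hasDerivAt).deriv]
  field_simp

lemma powNear_mul (w₀ p q w : ℂ) : powNear w₀ p w * powNear w₀ q w = powNear w₀ (p + q) w := by
  simp only [powNear, ← Complex.exp_add]
  ring_nf

/-- The factor by which `eulerOp α k` multiplies `w ^ m`. -/
noncomputable def eulerFactor (α : ℝ) (k m : ℕ) : ℂ :=
  ((m : ℂ) + (2 * k - 3 / 2 + α / 2)) * ((m : ℂ) + (2 * k - 2 - α / 2))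

lemma Conv.eulerFactor_mul {a : ℕ → ℂ} (h : Conv a) (α : ℝ) (k : ℕ) :
    Conv fun m => eulerFactor α k m * a m := by
  simpa [eulerFactor, mul_assoc] using
    (h.add_mul (2 * k - 2 - α / 2)).add_mul (2 * k - 3 / 2 + α / 2)

/-- Conjugation by powers of `w` turns the two copies of `w ∂_w` into `w ∂_w + p` and `w ∂_w + q`,
which act diagonally on monomials. Agreement of `f` with the series off `0` suffices, since the
derivatives are taken at `w ≠ 0` and are local. -/
lemma eulerOp_eq_psum {α : ℝ} {k : ℕ} {a : ℕ → ℂ} {f : ℂ → ℂ} (h : Conv a)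
    (hf : ∀ w : ℂ, 0 < ‖w‖ → ‖w‖ < 1 → f w = psum a w) {w : ℂ} (hw0 : 0 < ‖w‖) (hw : ‖w‖ < 1) :
    eulerOp α k f w = psum (fun m => eulerFactor α k m * a m) w := by
  have hne : w ≠ 0 := norm_pos_iff.mp hw0
  set p : ℂ := 2 * k - 2 - α / 2 with hp
  set q : ℂ := 2 * k - 3 / 2 + α / 2 with hq
  have hU : ∀ᶠ z : ℂ in 𝓝 w, 0 < ‖z‖ ∧ ‖z‖ < 1 ∧ z / w ∈ Complex.slitPlane := by
    refine (continuous_norm.continuousAt.eventually (lt_mem_nhds hw0)).and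
      ((continuous_norm.continuousAt.eventually (gt_mem_nhds hw)).and ?_)
    have : ContinuousAt (fun z : ℂ => z / w) w := by fun_prop
    refine this.eventually (Complex.isOpen_slitPlane.mem_nhds ?_)
    simp [hne]
  have hf' : ∀ᶠ z : ℂ in 𝓝 w, f =ᶠ[𝓝 z] psum a := by
    refine Eventually.mono hU.eventually_nhds fun z hz => hz.mono fun y hy => hf y hy.1 hy.2.1
  have hP := h.add_mul p
  have hg : (fun w₁ => powNear w (α + 1 / 2) w₁ *
        (w₁ * deriv (fun w₂ => powNear w p w₂ * f w₂) w₁)) =ᶠ[𝓝 w]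
      fun z => powNear w q z * psum (fun m => ((m : ℂ) + p) * a m) z := by
    filter_upwards [hU, hf'] with z hz hfz
    have e : (fun w₂ => powNear w p w₂ * f w₂) =ᶠ[𝓝 z] fun w₂ => powNear w p w₂ * psum a w₂ :=
      hfz.mono fun y hy => by simp only [hy]
    rw [e.deriv_eq, mul_deriv_powNear_mul hz.2.2 hne (psum_differentiableAt h hz.2.1), ← mul_assoc, powNear_mul, psum_natCast_add_mul h p hz.2.1]
    congr 2
    rw [hp, hq]; ring
  unfold eulerOp
  rw [hg.deriv_eq, mul_deriv_powNear_mul (by simp [hne]) hne (psum_differentiableAt hP hw),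
    ← psum_natCast_add_mul hP q hw, ← mul_assoc, powNear_mul]
  rw [← hq, neg_add_cancel]
  simp [powNear, eulerFactor, mul_assoc, hp, hq]

/-! ### The recurrence and the differential equation -/

/-- The coefficients of the Lamé series satisfy the recurrence in symmetric form. -/
lemma coeff_recurrence (ρ α h : ℝ) (n : ℕ) :
    ((n : ℝ) + 2) * (n + 3 / 2) * coeff ρ α h (n + 2) =
      ((1 + ρ ^ 2) * (n + 1) ^ 2 - h / 4) * coeff ρ α h (n + 1) -
        ρ ^ 2 * (n - α / 2) * (n + 1 / 2 + α / 2) * coeff ρ α h n := by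
  rw [coeff]
  field_simp
  ring

lemma LF_equationAt {ρ α h : ℝ} (hρ₀ : 0 < ρ) (hρ₁ : ρ < 1)
    (hc : Conv fun n => (coeff ρ α h n : ℂ)) {ξ : ℂ} (hξ : ‖ξ‖ < 1) (h0 : ξ ≠ 0) :
    EquationAt ρ α h (LF ρ α h) ξ := by
  set c : ℕ → ℂ := fun n => (coeff ρ α h n : ℂ) with hcdef
  have hLF : LF ρ α h = psum c := rfl
  have h1 := hc.natCast_mul
  have e1 : ξ * deriv (psum c) ξ = psum (fun n => (n : ℂ) * c n) ξ := mul_deriv_psum hc hξ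
  have e2 : ξ * deriv (psum fun n => (n : ℂ) * c n) ξ = psum (fun n => (n : ℂ) * (n * c n)) ξ :=
    mul_deriv_psum h1 hξ
  have hball : Metric.ball (0 : ℂ) 1 ∈ 𝓝 ξ := Metric.isOpen_ball.mem_nhds (by simpa using hξ)
  have hd : deriv (psum fun n => (n : ℂ) * c n) ξ
      = deriv (psum c) ξ + ξ * deriv (deriv (psum c)) ξ := by
    have : (psum fun n => (n : ℂ) * c n) =ᶠ[𝓝 ξ] fun z => z * deriv (psum c) z := by
      filter_upwards [hball] with z hz
      exact (mul_deriv_psum hc (by simpa using hz)).symm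
    rw [this.deriv_eq, deriv_fun_mul differentiableAt_fun_id
      (((psum_differentiableOn hc).deriv Metric.isOpen_ball).differentiableAt hball)]
    simp
  -- The three sequences belong to `θ(θ - 1/2)`, `(1 + ρ²)θ² - h/4` and `-ρ²(θ + 1/2 + α/2)(θ -
  -- α/2)` applied to the series.
  have hrec := psum_eq_of_recurrence (x := ξ) hξ
    (d := fun n => ((n : ℂ) + (-1 / 2)) * (n * c n))
    (e := fun n => (1 + (ρ : ℂ) ^ 2) * (n * (n * c n)) - h / 4 * c n)
    (f := fun n => -(ρ : ℂ) ^ 2 * (((n : ℂ) + (1 / 2 + α / 2)) * ((n + (-α / 2)) * c n)))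
    (h1.add_mul _)
    (fun x hx => (((h1.natCast_mul x hx).mul_left (1 + (ρ : ℂ) ^ 2)).sub
      ((hc x hx).mul_left (h / 4 : ℂ))).congr fun n => by ring)
    (fun x hx => (((hc.add_mul (-α / 2)).add_mul (1 / 2 + α / 2) x hx).mul_left
      (-(ρ : ℂ) ^ 2)).congr fun n => by ring)
    (by simp) (by simp [hcdef, coeff]; ring)
    (fun n => by
      have := congrArg (Complex.ofReal) (coeff_recurrence ρ α h n)
      push_cast at this ⊢
      simp only [hcdef]
      linear_combination this)
  have s1 : psum (fun n => ((n : ℂ) + (-1 / 2)) * (n * c n)) ξ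
      = psum (fun n => (n : ℂ) * (n * c n)) ξ - 1 / 2 * psum (fun n => (n : ℂ) * c n) ξ := by
    rw [psum_natCast_add_mul h1 _ hξ, e2]; ring
  have s2 : psum (fun n => (1 + (ρ : ℂ) ^ 2) * (n * (n * c n)) - h / 4 * c n) ξ
      = (1 + (ρ : ℂ) ^ 2) * psum (fun n => (n : ℂ) * (n * c n)) ξ - h / 4 * psum c ξ := by
    refine (HasSum.tsum_eq ((((h1.natCast_mul.hasSum hξ).mul_left (1 + (ρ : ℂ) ^ 2)).sub
      ((hc.hasSum hξ).mul_left (h / 4 : ℂ))).congr_fun fun n => ?_))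
    ring
  have s3 : psum (fun n => -(ρ : ℂ) ^ 2 * (((n : ℂ) + (1 / 2 + α / 2)) * ((n + (-α / 2)) * c n))) ξ
      = -(ρ : ℂ) ^ 2 * (psum (fun n => (n : ℂ) * (n * c n)) ξ
        + 1 / 2 * psum (fun n => (n : ℂ) * c n) ξ - (1 / 2 + α / 2) * (α / 2) * psum c ξ) := by
    refine (HasSum.tsum_eq (((((h1.natCast_mul.hasSum hξ).add
      ((h1.hasSum hξ).mul_left (1 / 2 : ℂ))).sub
      ((hc.hasSum hξ).mul_left ((1 / 2 + α / 2) * (α / 2) : ℂ))).mul_left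
        (-(ρ : ℂ) ^ 2)).congr_fun fun n => ?_))
    ring
  rw [s1, s2, s3, ← e2, ← e1, hd] at hrec
  unfold EquationAt
  rw [hLF]
  have hρ : (ρ : ℂ) ≠ 0 := by exact_mod_cast hρ₀.ne'
  have hξ1 : ξ - 1 ≠ 0 := by
    intro h'
    rw [sub_eq_zero.mp h'] at hξ
    simp at hξ
  have hξ2 : ξ * (ρ : ℂ) ^ 2 - 1 ≠ 0 := by
    intro h'
    have := congrArg norm (sub_eq_zero.mp h')
    simp at this
    nlinarith [norm_nonneg ξ, pow_pos hρ₀ 2, pow_lt_one₀ hρ₀.le hρ₁ two_ne_zero]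
  have hξ3 : ξ - ((ρ : ℂ) ^ 2)⁻¹ ≠ 0 := by
    intro h'
    apply hξ2
    rw [sub_eq_zero.mp h']
    field_simp
    simp
  -- The bracket is the left side of the equation multiplied by `ξ (ξ - 1)(ρ² ξ - 1)`; the `θ`-form
  -- carries one further factor `ξ`.
  have key : ξ * (ξ * (ξ * (ρ : ℂ) ^ 2 - 1) * (ξ - 1) * deriv (deriv (psum c)) ξ + 1 / 2 *
      ((ξ * (ρ : ℂ) ^ 2 - 1) * (ξ - 1) + ξ * (ξ * (ρ : ℂ) ^ 2 - 1) + ξ * (ξ - 1) * (ρ : ℂ) ^ 2)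
        * deriv (psum c) ξ
      + (-(α : ℂ) * (α + 1) * ξ * (ρ : ℂ) ^ 2 + h) / 4 * psum c ξ) = 0 := by
    linear_combination hrec
  have key' := (mul_eq_zero.mp key).resolve_left h0
  have e3 : ξ - ((ρ : ℂ) ^ 2)⁻¹ = (ξ * (ρ : ℂ) ^ 2 - 1) / (ρ : ℂ) ^ 2 := by field_simp
  rw [e3]
  field_simp
  linear_combination 8 * key'

/-! ### Convergence of the Frobenius series on the unit disc -/

lemma tendsto_quadratic_div (a b c : ℝ) :
    Tendsto (fun n : ℕ => (a * (n : ℝ) ^ 2 + b * n + c) / (((n : ℝ) + 2) * (n + 3 / 2))) atTop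
      (𝓝 a) := by
  have hi (d : ℝ) : Tendsto (fun n : ℕ => d / (n : ℝ)) atTop (𝓝 0) :=
    tendsto_const_div_atTop_nhds_zero_nat d
  have h := (((hi b).const_add a).add ((hi c).mul (hi 1))).div
    (((hi 2).const_add 1).mul ((hi (3 / 2)).const_add 1)) (by norm_num)
  simp only [add_zero, mul_zero, mul_one, div_one] at h
  refine h.congr' ?_
  filter_upwards [eventually_gt_atTop 0] with n hn
  have : (n : ℝ) ≠ 0 := by positivity
  simp only [Pi.div_apply]
  field_simp

/-- A perturbation of the recurrence `c (n + 2) = (1 + q) c (n + 1) - q c n`, whose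
characteristic roots are `1` and `q`, has solutions of at most subexponential growth. -/
lemma summable_of_perturbed_recurrence {q : ℝ} (hq0 : 0 < q) (hq1 : q < 1) {c u v : ℕ → ℝ}
    (hu : Tendsto u atTop (𝓝 0)) (hv : Tendsto v atTop (𝓝 0))
    (hc : ∀ n, c (n + 2) = (1 + q) * c (n + 1) - q * c n + u n * c (n + 1) + v n * c n)
    {r : ℝ} (hr0 : 0 < r) (hr1 : r < 1) : Summable fun n => |c n| * r ^ n := by
  obtain ⟨l, hl1, hlr⟩ : ∃ l : ℝ, 1 < l ∧ l * r < 1 := by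
    obtain ⟨l, h1, h2⟩ := exists_between ((one_lt_inv₀ hr0).mpr hr1)
    exact ⟨l, h1, by rwa [lt_inv_comm₀ (by linarith) hr0, ← one_div, lt_div_iff₀' (by linarith)] at h2⟩
  set μ := (l - 1) / 2 with hμ
  have hμ0 : 0 < μ := by rw [hμ]; linarith
  -- The difference `c (n + 1) - q c n` is constant for the unperturbed recurrence, and up to this
  -- difference `c` contracts by `q`. The small weight `μ` makes both growth conditions hold: `1 + μ
  -- < l` and `μ q < l μ`.
  set X : ℕ → ℝ := fun n => |c (n + 1) - q * c n| + μ * |c (n + 1)| with hX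
  have hX0 : ∀ n, 0 ≤ X n := fun n => by positivity
  have hv' : Tendsto (fun n => (1 + μ) * (1 + |v n| / q)) atTop (𝓝 ((1 + μ) * (1 + |0| / q))) :=
    ((hv.abs.div_const q).const_add 1).const_mul _
  have hu' : Tendsto (fun n => (1 + μ) * (|u n| + |v n| / q) + μ * q) atTop
      (𝓝 ((1 + μ) * (|0| + |0| / q) + μ * q)) :=
    ((hu.abs.add (hv.abs.div_const q)).const_mul _).add_const _
  have hstep : ∀ᶠ n in atTop, X (n + 1) ≤ l * X n := by
    have hvl : (1 + μ) * (1 + |0| / q) < l := by rw [abs_zero, zero_div]; linarith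
    have hul : (1 + μ) * (|0| + |0| / q) + μ * q < l * μ := by
      rw [abs_zero, zero_div, add_zero, mul_zero, zero_add]; nlinarith
    filter_upwards [hv'.eventually (gt_mem_nhds hvl), hu'.eventually (gt_mem_nhds hul)] with n h1 h2
    have he : c (n + 2) - q * c (n + 1) = (c (n + 1) - q * c n) + u n * c (n + 1) + v n * c n := by
      rw [hc]; ring
    have hcn : |c n| ≤ (|c (n + 1)| + |c (n + 1) - q * c n|) / q := by
      rw [le_div_iff₀ hq0]
      calc |c n| * q = |c (n + 1) - (c (n + 1) - q * c n)| := by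
            rw [sub_sub_cancel, abs_mul, abs_of_pos hq0, mul_comm]
        _ ≤ _ := abs_sub _ _
    have he' : |c (n + 2) - q * c (n + 1)| ≤ |c (n + 1) - q * c n| + |u n| * |c (n + 1)|
        + |v n| * ((|c (n + 1)| + |c (n + 1) - q * c n|) / q) := by
      rw [he]
      refine (abs_add_le _ _).trans ?_
      refine add_le_add ((abs_add_le _ _).trans (by rw [abs_mul])) ?_
      rw [abs_mul]
      gcongr
    have hc2 : |c (n + 2)| ≤ |c (n + 2) - q * c (n + 1)| + q * |c (n + 1)| := by
      calc |c (n + 2)| = |(c (n + 2) - q * c (n + 1)) + q * c (n + 1)| := by ring_nf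
        _ ≤ _ := (abs_add_le _ _).trans (by rw [abs_mul q, abs_of_pos hq0])
    simp only [hX]
    set A := |c (n + 1) - q * c n|
    set B := |c (n + 1)|
    have hA : 0 ≤ A := abs_nonneg _
    have hB : 0 ≤ B := abs_nonneg _
    calc |c (n + 2) - q * c (n + 1)| + μ * |c (n + 2)|
        ≤ (1 + μ) * |c (n + 2) - q * c (n + 1)| + μ * q * B := by
          nlinarith [mul_le_mul_of_nonneg_left hc2 hμ0.le]
      _ ≤ (1 + μ) * (A + |u n| * B + |v n| * ((B + A) / q)) + μ * q * B := by gcongr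
      _ = (1 + μ) * (1 + |v n| / q) * A + ((1 + μ) * (|u n| + |v n| / q) + μ * q) * B := by
          field_simp; ring
      _ ≤ l * A + l * μ * B := by gcongr
      _ = l * (A + μ * B) := by ring
  have hsum : Summable fun n => X n * r ^ n := by
    refine summable_of_ratio_norm_eventually_le hlr ?_
    filter_upwards [hstep] with n hn
    rw [Real.norm_of_nonneg (by have := hX0 (n + 1); positivity),
      Real.norm_of_nonneg (by have := hX0 n; positivity)]
    calc X (n + 1) * r ^ (n + 1) ≤ l * X n * r ^ (n + 1) := by gcongr
      _ = _ := by ring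
  refine (summable_nat_add_iff 1).mp ?_
  refine .of_nonneg_of_le (fun n => by positivity) (fun n => ?_) (hsum.mul_left (r / μ))
  have : |c (n + 1)| ≤ X n / μ := by
    rw [le_div_iff₀ hμ0]
    simp only [hX]
    nlinarith [abs_nonneg (c (n + 1) - q * c n)]
  calc |c (n + 1)| * r ^ (n + 1) ≤ X n / μ * r ^ (n + 1) := by gcongr
    _ = _ := by ring

lemma conv_coeff {ρ α h : ℝ} (hρ₀ : 0 < ρ) (hρ₁ : ρ < 1) :
    Conv fun n => (coeff ρ α h n : ℂ) := by
  intro x hx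
  obtain ⟨r, hxr, hr⟩ := exists_between hx
  have hr0 : 0 < r := (norm_nonneg x).trans_lt hxr
  -- The numerators of the two recurrence coefficients, expanded in `n`; their quotients tend to `1
  -- + q` and `-q` with `q = ρ²`.
  have hu := (tendsto_quadratic_div (1 + ρ ^ 2) (2 * (1 + ρ ^ 2)) (1 + ρ ^ 2 - h / 4)).sub_const
    (1 + ρ ^ 2)
  have hv := (tendsto_quadratic_div (-ρ ^ 2) (-ρ ^ 2 / 2)
      (ρ ^ 2 * (α / 2) * (1 / 2 + α / 2))).add_const (ρ ^ 2)
  rw [sub_self] at hu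
  rw [neg_add_cancel] at hv
  have hs := summable_of_perturbed_recurrence (q := ρ ^ 2) (by positivity)
    (pow_lt_one₀ hρ₀.le hρ₁ two_ne_zero) (c := coeff ρ α h) hu hv (fun n => by
      have h2 : ((n : ℝ) + 2) * (n + 3 / 2) ≠ 0 := by positivity
      have := coeff_recurrence ρ α h n
      refine mul_left_cancel₀ h2 (this.trans ?_)
      field_simp
      ring) hr0 hr
  refine .of_norm_bounded hs fun n => ?_
  rw [norm_mul, norm_pow, Complex.norm_real, Real.norm_eq_abs]
  gcongr

/-! ### The contour integral -/

/-- The rising factorial `a (a + 1) ⋯ (a + p - 1)`. -/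
noncomputable def rise (a : ℂ) (p : ℕ) : ℂ := ∏ j ∈ Finset.range p, (a + j)

lemma rise_succ (a : ℂ) (p : ℕ) : rise a (p + 1) = rise a p * (a + p) :=
  Finset.prod_range_succ _ _

lemma rise_eq_ascPochhammer_eval (a : ℂ) (p : ℕ) : rise a p = (ascPochhammer ℂ p).eval a := by
  induction p with
  | zero => simp [rise]
  | succ p ih => rw [rise_succ, ih, ascPochhammer_succ_eval]

open scoped Nat in
lemma hasSum_one_sub_cpow_neg (a : ℂ) {z : ℂ} (hz : ‖z‖ < 1) :
    HasSum (fun p => rise a p / p ! * z ^ p) ((1 - z) ^ (-a)) := by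
  have h := (Complex.one_div_one_sub_cpow_hasFPowerSeriesOnBall_zero a).hasSum (y := z)
    (by rwa [Metric.mem_eball, edist_zero_right, ← ofReal_norm, ENNReal.ofReal_lt_one])
  rw [zero_add, one_div, ← Complex.cpow_neg] at h
  refine h.congr_fun fun p => ?_
  have h1 := Ring.factorial_nsmul_multichoose_eq_ascPochhammer a p
  rw [Ring.multichoose_eq, Polynomial.ascPochhammer_smeval_eq_eval,
    ← rise_eq_ascPochhammer_eval, nsmul_eq_mul] at h1
  rw [FormalMultilinearSeries.ofScalars_apply_eq, ← h1, smul_eq_mul]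
  have : (p ! : ℂ) ≠ 0 := by exact_mod_cast p.factorial_ne_zero
  field_simp

lemma hasSum_circleIntegral_of_summable_bound {ι : Type*} [Countable ι] {F : ι → ℂ → ℂ}
    {f : ℂ → ℂ} {R : ℝ} (hR : 0 < R) {B : ι → ℝ} (hB : Summable B)
    (hF : ∀ i, ContinuousOn (F i) (Metric.sphere 0 R)) (hFB : ∀ i, ∀ v : ℂ, ‖v‖ = R → ‖F i v‖ ≤ B i)
    (hf : ∀ v : ℂ, ‖v‖ = R → HasSum (fun i => F i v) (f v)) :
    CircleIntegrable f 0 R ∧ HasSum (fun i => ∮ v in C(0, R), F i v) (∮ v in C(0, R), f v) := by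
  have hcm : ∀ θ, ‖circleMap 0 R θ‖ = R := fun θ => by simp [abs_of_pos hR]
  constructor
  · have hc : ContinuousOn f (Metric.sphere 0 R) :=
      (continuousOn_tsum hF hB fun i v hv => hFB i v (by simpa using hv)).congr
        fun v hv => (hf v (by simpa using hv)).tsum_eq.symm
    exact hc.circleIntegrable hR.le
  · refine intervalIntegral.hasSum_integral_of_dominated_convergence
      (fun i _ => R * B i) (fun i => ?_) (fun i => ?_) ?_ ?_ ?_
    · have := ((hF i).circleIntegrable hR.le).out
      exact this.def'.1
    · refine Eventually.of_forall fun θ _ => ?_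
      rw [norm_smul, deriv_circleMap, norm_mul, Complex.norm_I, mul_one, hcm]
      gcongr
      exact hFB i _ (hcm θ)
    · exact Eventually.of_forall fun _ _ => hB.mul_left _
    · exact intervalIntegrable_const
    · exact Eventually.of_forall fun θ _ => (hf _ (hcm θ)).const_smul _

lemma circleIntegral_zpow {R : ℝ} (hR : 0 < R) (p q : ℕ) :
    (∮ v in C(0, R), v⁻¹ * ((v⁻¹) ^ p * v ^ q)) = if p = q then 2 * Real.pi * Complex.I else 0 := by
  have h : (∮ v in C(0, R), v⁻¹ * ((v⁻¹) ^ p * v ^ q))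
      = ∮ v in C(0, R), (v - 0) ^ ((q : ℤ) - p - 1) := by
    refine circleIntegral.integral_congr hR.le fun v hv => ?_
    have hv0 : v ≠ 0 := by
      rintro rfl
      simp at hv
      exact hR.ne hv
    simp only [sub_zero, zpow_sub₀ hv0, zpow_natCast, zpow_one, inv_pow]
    field_simp
  rw [h]
  split_ifs with hpq
  · subst hpq
    simpa using circleIntegral.integral_sub_center_inv 0 hR.ne'
  · exact circleIntegral.integral_sub_zpow_of_ne (by omega) _ _ _

/-- The kernel `∑ (a)_p (b)_p / p!² X ^ p`. -/
noncomputable def kernelSum (a b X : ℂ) : ℂ :=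
  ∑' p : ℕ, rise a p * rise b p / (p.factorial : ℂ) ^ 2 * X ^ p

lemma one_sub_inv_mem {R : ℝ} (hR : 1 < R) {v : ℂ} (hv : ‖v‖ = R) :
    v ≠ 0 ∧ ‖v⁻¹‖ < 1 ∧ (v - 1) / v = 1 - v⁻¹ ∧ (v - 1) / v ∈ Complex.slitPlane := by
  have hv0 : v ≠ 0 := by
    rintro rfl
    simp at hv
    linarith
  have h1 : ‖v⁻¹‖ < 1 := by
    rw [norm_inv, hv]
    exact inv_lt_one_of_one_lt₀ hR
  have h2 : (v - 1) / v = 1 - v⁻¹ := by field_simp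
  refine ⟨hv0, h1, h2, ?_⟩
  rw [h2, sub_eq_add_neg]
  exact Complex.mem_slitPlane_of_norm_lt_one (by simpa using h1)

lemma one_sub_mul_mem {R : ℝ} {X v : ℂ} (hX : ‖X‖ * R < 1) (hv : ‖v‖ = R) :
    ‖X * v‖ < 1 ∧ 1 - X * v ∈ Complex.slitPlane := by
  have h : ‖X * v‖ < 1 := by rwa [norm_mul, hv]
  refine ⟨h, ?_⟩
  rw [sub_eq_add_neg]
  exact Complex.mem_slitPlane_of_norm_lt_one (by simpa using h)

lemma summable_rise (a : ℂ) {r : ℝ} (hr0 : 0 ≤ r) (hr : r < 1) :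
    Summable fun p => ‖rise a p / p.factorial‖ * r ^ p := by
  have h0 : ‖(r : ℂ)‖ < 1 := by rwa [Complex.norm_real, Real.norm_of_nonneg hr0]
  have := (hasSum_one_sub_cpow_neg a h0).summable.norm
  simpa [abs_of_nonneg hr0] using this

lemma hasSum_kernel_on_circle (a b : ℂ) {X : ℂ} {R : ℝ} (hR : 1 < R) (hX : ‖X‖ * R < 1) {v : ℂ}
    (hv : ‖v‖ = R) :
    HasSum (fun i : ℕ × ℕ => (rise a i.1 / i.1.factorial * (rise b i.2 / i.2.factorial) * X ^ i.2) *
      (v⁻¹ * ((v⁻¹) ^ i.1 * v ^ i.2))) (1 / v * ((v - 1) / v) ^ (-a) * (1 - X * v) ^ (-b)) := by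
  obtain ⟨hv0, hv1, hv2, -⟩ := one_sub_inv_mem hR hv
  obtain ⟨hXv, -⟩ := one_sub_mul_mem hX hv
  have s1 := hasSum_one_sub_cpow_neg a hv1
  have s2 := hasSum_one_sub_cpow_neg b hXv
  have h := (summable_mul_of_summable_norm s1.summable.norm s2.summable.norm).hasSum
  rw [← tsum_mul_tsum_of_summable_norm s1.summable.norm s2.summable.norm, s1.tsum_eq,
    s2.tsum_eq] at h
  have e1 : 1 / v * ((v - 1) / v) ^ (-a) * (1 - X * v) ^ (-b)
      = v⁻¹ * ((1 - v⁻¹) ^ (-a) * (1 - X * v) ^ (-b)) := by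
    rw [hv2, one_div, mul_assoc]
  rw [e1]
  refine (h.mul_left v⁻¹).congr_fun fun i => ?_
  rw [mul_pow]
  ring

/-- On the circle both `v⁻¹` and `X v` have modulus below `1`, so both binomial series converge
absolutely and uniformly; integration of `dv / v` keeps only the terms with equal powers. -/
lemma hasSum_circleIntegral_kernel (a b : ℂ) {X : ℂ} {R : ℝ} (hR : 1 < R) (hX : ‖X‖ * R < 1) :
    HasSum (fun i : ℕ × ℕ => (rise a i.1 / i.1.factorial * (rise b i.2 / i.2.factorial) * X ^ i.2) *
      (if i.1 = i.2 then 2 * Real.pi * Complex.I else 0))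
      (∮ v in C(0, R), 1 / v * ((v - 1) / v) ^ (-a) * (1 - X * v) ^ (-b)) := by
  have hR0 : 0 < R := by linarith
  have hAs := summable_rise a (inv_nonneg.mpr hR0.le) (inv_lt_one_of_one_lt₀ hR)
  have hBs := summable_rise b (by positivity : 0 ≤ ‖X‖ * R) hX
  have hAB := (hAs.mul_of_nonneg hBs (fun _ => by positivity) (fun _ => by positivity)).mul_left R⁻¹
  have hF : ∀ i : ℕ × ℕ, ContinuousOn (fun v : ℂ =>
      (rise a i.1 / i.1.factorial * (rise b i.2 / i.2.factorial) * X ^ i.2) *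
      (v⁻¹ * ((v⁻¹) ^ i.1 * v ^ i.2))) (Metric.sphere 0 R) := fun i => by
    have : ∀ v ∈ Metric.sphere (0 : ℂ) R, v ≠ 0 := fun v hv =>
      (one_sub_inv_mem hR (by simpa using hv)).1
    have hi : ContinuousOn (fun v : ℂ => v⁻¹) (Metric.sphere 0 R) := continuousOn_id.inv₀ this
    exact continuousOn_const.mul (hi.mul ((hi.pow _).mul (continuousOn_id.pow _)))
  have hmain := (hasSum_circleIntegral_of_summable_bound hR0 hAB hF
    (fun i v hv => by
      simp only [norm_mul, norm_pow, norm_inv, hv]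
      rw [mul_pow]
      exact le_of_eq (by ring))
    (fun v hv => hasSum_kernel_on_circle a b hR hX hv)).2
  simpa only [circleIntegral.integral_const_mul, circleIntegral_zpow hR0] using hmain

lemma circleIntegral_kernel (a b : ℂ) {X : ℂ} {R : ℝ} (hR : 1 < R) (hX : ‖X‖ * R < 1) :
    1 / (2 * Real.pi * Complex.I) *
      (∮ v in C(0, R), 1 / v * ((v - 1) / v) ^ (-a) * (1 - X * v) ^ (-b)) = kernelSum a b X := by
  have hfib := (hasSum_circleIntegral_kernel a b hR hX).prod_fiberwise
    (g := fun p => rise a p / p.factorial * (rise b p / p.factorial) * X ^ p *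
      (2 * Real.pi * Complex.I))
    (fun p => by
      refine (hasSum_ite_eq p (rise a p / p.factorial * (rise b p / p.factorial) * X ^ p *
        (2 * Real.pi * Complex.I))).congr_fun fun q => ?_
      by_cases hq : q = p
      · subst hq; simp
      · simp [hq, Ne.symm hq])
  have hpi : (2 * Real.pi * Complex.I : ℂ) ≠ 0 := Complex.two_pi_I_ne_zero
  have h := (hfib.mul_left (1 / (2 * Real.pi * Complex.I))).tsum_eq
  rw [← h, kernelSum]
  refine tsum_congr fun p => ?_
  generalize (2 * Real.pi * Complex.I : ℂ) = z at hpi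
  field_simp

/-- With `P = (v - 1) / v` and `Q = 1 - X v`, a factor `w ^ m` merely shifts both exponents of the
kernel by `m`. -/
lemma div_mul_cpow_mul_pow {P Q y : ℂ} (hP : P ≠ 0) (hQ : Q ≠ 0) (a b : ℂ) (m : ℕ) :
    P ^ (-a) * Q ^ (-b) * (P⁻¹ * (y / Q)) ^ m
      = y ^ m * (P ^ (-(a + m)) * Q ^ (-(b + m))) := by
  rw [neg_add, neg_add, Complex.cpow_add _ _ hP, Complex.cpow_add _ _ hQ, Complex.cpow_neg P m,
    Complex.cpow_neg Q m, Complex.cpow_natCast, Complex.cpow_natCast, mul_pow, div_pow, inv_pow]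
  field_simp

/-- The contour integral of a power series in `w = v / (v - 1) * (y / (1 - X v))`. -/
lemma circleIntegral_psum {b : ℕ → ℂ} (hb : Conv b) (A B y : ℂ) {X : ℂ} {R : ℝ} (hR : 1 < R)
    (hX : ‖X‖ * R < 1) (hw : ∀ v : ℂ, ‖v‖ = R → ‖v / (v - 1) * (y / (1 - X * v))‖ < 1) :
    CircleIntegrable (fun v => 1 / v * ((v - 1) / v) ^ (-A) * (1 - X * v) ^ (-B) *
      psum b (v / (v - 1) * (y / (1 - X * v)))) 0 R ∧
    HasSum (fun m : ℕ => b m * y ^ m * kernelSum (A + m) (B + m) X)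
      (1 / (2 * Real.pi * Complex.I) * ∮ v in C(0, R), 1 / v * ((v - 1) / v) ^ (-A) *
        (1 - X * v) ^ (-B) * psum b (v / (v - 1) * (y / (1 - X * v)))) := by
  have hR0 : 0 < R := by linarith
  have hslit : ∀ v ∈ Metric.sphere (0 : ℂ) R, v ≠ 0 ∧ v - 1 ≠ 0 ∧ 1 - X * v ≠ 0 ∧
      (v - 1) / v ∈ Complex.slitPlane ∧ 1 - X * v ∈ Complex.slitPlane := fun v hv => by
    have h1 := one_sub_inv_mem hR (by simpa using hv)
    have h2 := (one_sub_mul_mem (v := v) hX (by simpa using hv)).2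
    refine ⟨h1.1, fun h => ?_, Complex.slitPlane_ne_zero h2, h1.2.2.2, h2⟩
    exact Complex.slitPlane_ne_zero h1.2.2.2 (by rw [h, zero_div])
  have hcw : ContinuousOn (fun v : ℂ => v / (v - 1) * (y / (1 - X * v))) (Metric.sphere 0 R) := by
    have h1 := fun v hv => (hslit v hv).2.1
    have h2 := fun v hv => (hslit v hv).2.2.1
    fun_prop (disch := assumption)
  have hcker : ContinuousOn (fun v : ℂ => 1 / v * ((v - 1) / v) ^ (-A) * (1 - X * v) ^ (-B))
      (Metric.sphere 0 R) := by
    have h0 := fun v hv => (hslit v hv).1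
    have h3 := fun v hv => (hslit v hv).2.2.2.1
    have h4 := fun v hv => (hslit v hv).2.2.2.2
    have c1 : ContinuousOn (fun v : ℂ => (v - 1) / v) (Metric.sphere 0 R) := by
      fun_prop (disch := assumption)
    have c2 : ContinuousOn (fun v : ℂ => 1 - X * v) (Metric.sphere 0 R) := by fun_prop
    have c3 : ContinuousOn (fun v : ℂ => 1 / v) (Metric.sphere 0 R) := by
      fun_prop (disch := assumption)
    exact (c3.mul (c1.cpow continuousOn_const h3)).mul (c2.cpow continuousOn_const h4)
  have hcpt := isCompact_sphere (0 : ℂ) R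
  have hne : (Metric.sphere (0 : ℂ) R).Nonempty := NormedSpace.sphere_nonempty.mpr hR0.le
  -- Compactness of the circle turns `‖w‖ < 1` into a uniform bound `q < 1`, which gives the
  -- majorant for termwise integration.
  obtain ⟨v₀, hv₀, hmax⟩ := hcpt.exists_isMaxOn hne hcw.norm
  obtain ⟨C, hC⟩ := hcpt.exists_bound_of_continuousOn hcker
  set q := ‖v₀ / (v₀ - 1) * (y / (1 - X * v₀))‖
  have hq : q < 1 := hw v₀ (by simpa using hv₀)
  have hmain := hasSum_circleIntegral_of_summable_bound (ι := ℕ)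
    (F := fun m v => 1 / v * ((v - 1) / v) ^ (-A) * (1 - X * v) ^ (-B) *
      (b m * (v / (v - 1) * (y / (1 - X * v))) ^ m)) hR0
    ((hb.summable_norm (norm_nonneg _) hq).mul_left C)
    (fun m => hcker.mul (continuousOn_const.mul (hcw.pow m)))
    (fun m v hv => by
      have hv' : v ∈ Metric.sphere (0 : ℂ) R := by simpa using hv
      rw [norm_mul, norm_mul (b m), norm_pow]
      have h1 := hC v hv'
      have h2 : ‖v / (v - 1) * (y / (1 - X * v))‖ ≤ q := hmax hv'
      have : 0 ≤ C := (norm_nonneg _).trans h1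
      gcongr)
    (fun v hv => (hb.hasSum (hw v hv)).mul_left _)
  refine ⟨hmain.1, (hmain.2.mul_left (1 / (2 * Real.pi * Complex.I))).congr_fun fun m => ?_⟩
  rw [← circleIntegral_kernel (A + m) (B + m) hR hX, mul_left_comm,
    ← circleIntegral.integral_const_mul]
  congr 1
  refine circleIntegral.integral_congr hR0.le fun v hv => ?_
  obtain ⟨h0, h1, h2, h3, -⟩ := hslit v hv
  have := div_mul_cpow_mul_pow (y := y) (Complex.slitPlane_ne_zero h3) h2 A B m
  rw [inv_div] at this
  linear_combination (- b m * (1 / v)) * this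

/-! ### The integrals in `u` and `t` -/

/-- The coefficients of the double series of the contour integral at level `κ + 1`. -/
noncomputable def contourCoeff (s : ℂ) (κ m p : ℕ) : ℂ :=
  rise (2 * (κ + 1 : ℕ) - s + m) p * rise (2 * (κ + 1 : ℕ) + s + m) p / (p.factorial : ℂ) ^ 2

/-- The coefficients of the double series of the triple integral at level `κ + 1`. -/
noncomputable def kern (s : ℂ) (κ m p : ℕ) : ℂ :=
  rise (2 * (κ + 1 : ℕ) - s + m) p * rise (2 * (κ + 1 : ℕ) + s + m) p /
    (rise (2 * (κ + 1 : ℕ) + m) (p + 1) * rise (2 * (κ + 1 : ℕ) - 1 / 2 + m) (p + 1))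

/-- Paired factors are `M² - s²` with `M = N + 1 + j`, of norm at most `M² exp(‖s²‖ / M²)`; the
exponents telescope because `1 / M² ≤ 1 / (M - 1) - 1 / M`. -/
lemma norm_rise_mul_rise_le (s : ℂ) {N : ℕ} (hN : 0 < N) (p : ℕ) :
    ‖rise ((N + 1 : ℕ) - s) p * rise ((N + 1 : ℕ) + s) p‖ ≤
      Real.exp (‖s ^ 2‖ * (1 / N - 1 / (N + p))) * (((N + 1).ascFactorial p : ℕ) : ℝ) ^ 2 := by
  induction p with
  | zero => simp [rise]
  | succ p ih =>
    have hN' : (0 : ℝ) < N := by exact_mod_cast hN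
    have h1 : ‖((N + 1 : ℕ) - s + p) * ((N + 1 : ℕ) + s + p)‖ ≤
        Real.exp (‖s ^ 2‖ * (1 / (N + p) - 1 / (N + p + 1))) * ((N : ℝ) + 1 + p) ^ 2 := by
      have e : ((N + 1 : ℕ) - s + p) * ((N + 1 : ℕ) + s + p)
          = (((N + 1 + p : ℕ) : ℂ)) ^ 2 - s ^ 2 := by push_cast; ring
      have h2 : ‖s ^ 2‖ * (1 / (N + p) - 1 / (N + p + 1)) + 1 ≤
        Real.exp (‖s ^ 2‖ * (1 / (N + p) - 1 / (N + p + 1))) := Real.add_one_le_exp _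
      have h3 : ‖s ^ 2‖ ≤ ‖s ^ 2‖ * (1 / (N + p) - 1 / (N + p + 1)) * ((N : ℝ) + 1 + p) ^ 2 := by
        have : (1 / (N + p) - 1 / (N + p + 1)) * ((N : ℝ) + 1 + p) ^ 2 = 1 + 1 / (N + p) := by
          field_simp; ring
        rw [mul_assoc, this]
        exact le_mul_of_one_le_right (norm_nonneg _) (by
          have : (0 : ℝ) ≤ 1 / (N + p) := by positivity
          linarith)
      calc _ ≤ ((N : ℝ) + 1 + p) ^ 2 + ‖s ^ 2‖ := by
            rw [e]
            refine (norm_sub_le _ _).trans (le_of_eq ?_)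
            rw [norm_pow, Complex.norm_natCast]
            push_cast; ring
        _ ≤ (‖s ^ 2‖ * (1 / (N + p) - 1 / (N + p + 1)) + 1) * ((N : ℝ) + 1 + p) ^ 2 := by linarith
        _ ≤ _ := by gcongr
    rw [rise_succ, rise_succ, mul_mul_mul_comm, norm_mul, Nat.ascFactorial_succ]
    refine (mul_le_mul ih h1 (norm_nonneg _) (by positivity)).trans (le_of_eq ?_)
    rw [mul_mul_mul_comm, ← Real.exp_add]
    push_cast
    ring_nf

/-- A single term of the binomial expansion of `(t + (1 - t)) ^ (N + p) = 1`. -/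
lemma choose_mul_pow_le_one {t : ℝ} (h0 : 0 ≤ t) (h1 : t ≤ 1) (N p : ℕ) :
    ((N + p).choose p : ℝ) * (t ^ N * (1 - t) ^ p) ≤ 1 := by
  have h := add_pow t (1 - t) (N + p)
  rw [add_sub_cancel, one_pow] at h
  have h1' : 0 ≤ 1 - t := by linarith
  have := Finset.single_le_sum (f := fun m => t ^ m * (1 - t) ^ (N + p - m) * ((N + p).choose m : ℝ))
    (s := Finset.range (N + p + 1)) (a := N) (fun i _ => by positivity) (by simp)
  rw [← h] at this
  rw [Nat.add_sub_cancel_left, Nat.choose_symm_add] at this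
  linarith

/-- The coefficient is at most `exp ‖s²‖` times the square of `(N + p).choose p`, with `N = 2κ + 1 +
m`. One binomial is absorbed by the powers of `t`, the other by those of `u`, so the bound is
uniform in all indices. -/
lemma norm_contourCoeff_mul_le (s : ℂ) (κ m p : ℕ) {t u : ℝ} (ht0 : 0 ≤ t) (ht1 : t ≤ 1)
    (hu0 : 0 ≤ u) (hu1 : u ≤ 1) :
    ‖contourCoeff s κ m p‖ * (t ^ (2 * κ + 1 + m) * (1 - t) ^ p) *
      (u ^ (2 * κ + 1 + m) * (1 - u) ^ p) ≤ Real.exp ‖s ^ 2‖ := by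
  set N := 2 * κ + 1 + m with hN
  have hN0 : 0 < N := by omega
  have h := norm_rise_mul_rise_le s hN0 p
  have e1 : ((N + 1 : ℕ) : ℂ) - s = 2 * (κ + 1 : ℕ) - s + m := by rw [hN]; push_cast; ring
  have e2 : ((N + 1 : ℕ) : ℂ) + s = 2 * (κ + 1 : ℕ) + s + m := by rw [hN]; push_cast; ring
  have hexp : Real.exp (‖s ^ 2‖ * (1 / N - 1 / (N + p))) ≤ Real.exp ‖s ^ 2‖ := by
    apply Real.exp_le_exp.mpr
    refine mul_le_of_le_one_right (norm_nonneg _) ?_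
    have a1 : (1 : ℝ) / N ≤ 1 := by
      rw [div_le_one (by positivity)]
      exact_mod_cast hN0
    have a2 : (0 : ℝ) ≤ 1 / (N + p) := by positivity
    linarith
  have hc : ‖contourCoeff s κ m p‖ ≤ Real.exp ‖s ^ 2‖ * ((N + p).choose p : ℝ) ^ 2 := by
    have hp : (0 : ℝ) < p.factorial := by exact_mod_cast p.factorial_pos
    rw [contourCoeff, ← e1, ← e2, norm_div, norm_pow, Complex.norm_natCast, div_le_iff₀ (by positivity)]
    refine h.trans ?_
    rw [Nat.ascFactorial_eq_factorial_mul_choose]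
    push_cast
    calc _ ≤ Real.exp ‖s ^ 2‖ * ((p.factorial : ℝ) * ((N + p).choose p : ℝ)) ^ 2 := by gcongr
      _ = _ := by ring
  have ht := choose_mul_pow_le_one ht0 ht1 N p
  have hu := choose_mul_pow_le_one hu0 hu1 N p
  have ht1' : 0 ≤ 1 - t := by linarith
  have hu1' : 0 ≤ 1 - u := by linarith
  calc _ ≤ Real.exp ‖s ^ 2‖ * ((N + p).choose p : ℝ) ^ 2 * (t ^ N * (1 - t) ^ p) *
        (u ^ N * (1 - u) ^ p) := by gcongr
    _ = Real.exp ‖s ^ 2‖ * ((((N + p).choose p : ℝ) * (t ^ N * (1 - t) ^ p)) *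
        (((N + p).choose p : ℝ) * (u ^ N * (1 - u) ^ p))) := by ring
    _ ≤ Real.exp ‖s ^ 2‖ * (1 * 1) := by gcongr
    _ = _ := by ring

/-- Term-by-term integration over `(0, 1)` under a product bound. -/
lemma hasSum_integral_of_product_bound {ι : Type*} [Countable ι] {F : ι → ℝ → ℂ} {f : ℝ → ℂ}
    {c : ι → ℝ} {g : ℝ → ℝ} (hc : Summable c) (hg : IntervalIntegrable g volume 0 1)
    (hF : ∀ i, ContinuousOn (F i) (Set.Ioo 0 1))
    (hb : ∀ i, ∀ u ∈ Set.Ioo (0 : ℝ) 1, ‖F i u‖ ≤ c i * g u)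
    (hf : ∀ u ∈ Set.Ioo (0 : ℝ) 1, HasSum (fun i => F i u) (f u)) :
    IntervalIntegrable f volume 0 1 ∧
      HasSum (fun i => ∫ u in (0 : ℝ)..1, F i u) (∫ u in (0 : ℝ)..1, f u) := by
  rw [intervalIntegrable_iff_integrableOn_Ioo_of_le zero_le_one] at hg ⊢
  simp only [intervalIntegral.integral_of_le zero_le_one, integral_Ioc_eq_integral_Ioo]
  have hae : ∀ᵐ u ∂(volume.restrict (Set.Ioo (0 : ℝ) 1)), u ∈ Set.Ioo (0 : ℝ) 1 :=
    ae_restrict_mem measurableSet_Ioo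
  have hm : ∀ i, AEStronglyMeasurable (F i) (volume.restrict (Set.Ioo (0 : ℝ) 1)) := fun i =>
    (hF i).aestronglyMeasurable measurableSet_Ioo
  have hint : Integrable (fun u => ∑' i, c i * g u) (volume.restrict (Set.Ioo (0 : ℝ) 1)) := by
    simp only [tsum_mul_right]
    exact hg.const_mul _
  constructor
  · refine hint.mono' ?_ ?_
    · refine aestronglyMeasurable_of_tendsto_ae (atTop : Filter (Finset ι))
        (f := fun s u => ∑ i ∈ s, F i u) (fun s => ?_) ?_
      · exact Finset.aestronglyMeasurable_fun_sum s fun i _ => hm i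
      · filter_upwards [hae] with u hu
        exact hf u hu
    · filter_upwards [hae] with u hu
      rw [← (hf u hu).tsum_eq]
      exact tsum_of_norm_bounded (hc.mul_right (g u)).hasSum fun i => hb i u hu
  · refine hasSum_integral_of_dominated_convergence (fun i u => c i * g u) hm (fun i => ?_) ?_ hint ?_
    · filter_upwards [hae] with u hu using hb i u hu
    · exact Eventually.of_forall fun u => hc.mul_right _
    · filter_upwards [hae] with u hu using hf u hu

/-- The Beta integral `B(a, p + 1)`. -/
lemma integral_rpow_mul_one_sub_pow {a : ℝ} (ha : 0 < a) (p : ℕ) :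
    ∫ u in (0 : ℝ)..1, ((u ^ (a - 1) * (1 - u) ^ p : ℝ) : ℂ) = p.factorial / rise a (p + 1) := by
  rw [rise, ← Complex.betaIntegral_eval_nat_add_one_right (by simpa using ha) p,
    Complex.betaIntegral]
  refine intervalIntegral.integral_congr fun u hu => ?_
  rw [Set.uIcc_of_le zero_le_one] at hu
  simp only [add_sub_cancel_right, Complex.cpow_natCast]
  push_cast
  rw [Complex.ofReal_cpow hu.1]
  push_cast
  rfl

/-- The double series that represents the contour integral. -/
noncomputable def contourTerm (s : ℂ) (κ : ℕ) (b : ℕ → ℂ) (x : ℂ) (t u : ℝ) (i : ℕ × ℕ) : ℂ :=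
  b i.1 * x ^ (i.1 + i.2) * contourCoeff s κ i.1 i.2 * ((t ^ i.1 * (1 - t) ^ i.2 : ℝ) : ℂ) *
    ((u ^ i.1 * (1 - u) ^ i.2 : ℝ) : ℂ)

/-- The summable majorant. -/
noncomputable def majorant (s : ℂ) (b : ℕ → ℂ) (x : ℂ) (i : ℕ × ℕ) : ℝ :=
  Real.exp ‖s ^ 2‖ * (‖b i.1‖ * ‖x‖ ^ i.1 * ‖x‖ ^ i.2)

lemma summable_majorant (s : ℂ) {b : ℕ → ℂ} (hb : Conv b) {x : ℂ} (hx : ‖x‖ < 1) :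
    Summable (majorant s b x) := by
  refine Summable.mul_left _ ?_
  exact (hb.summable_norm (norm_nonneg x) hx).mul_of_nonneg
    (summable_geometric_of_lt_one (norm_nonneg x) hx) (fun _ => by positivity)
    (fun _ => by positivity)

lemma norm_contourTerm_mul_le (s : ℂ) (κ : ℕ) (b : ℕ → ℂ) (x : ℂ) {t u : ℝ} (ht0 : 0 ≤ t)
    (ht1 : t ≤ 1) (hu0 : 0 ≤ u) (hu1 : u ≤ 1) (i : ℕ × ℕ) :
    t ^ (2 * κ + 1) * u ^ (2 * κ + 1) * ‖contourTerm s κ b x t u i‖ ≤ majorant s b x i := by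
  have h := norm_contourCoeff_mul_le s κ i.1 i.2 ht0 ht1 hu0 hu1
  have ht1' : 0 ≤ 1 - t := by linarith
  have hu1' : 0 ≤ 1 - u := by linarith
  rw [norm_pow s] at h
  simp only [contourTerm, majorant, norm_mul, Complex.norm_real, norm_pow, Real.norm_eq_abs,
    abs_of_nonneg ht0, abs_of_nonneg ht1', abs_of_nonneg hu0, abs_of_nonneg hu1']
  calc _ = (‖contourCoeff s κ i.1 i.2‖ * (t ^ (2 * κ + 1 + i.1) * (1 - t) ^ i.2) *
      (u ^ (2 * κ + 1 + i.1) * (1 - u) ^ i.2)) * (‖b i.1‖ * ‖x‖ ^ i.1 * ‖x‖ ^ i.2) := by ring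
    _ ≤ _ := by gcongr

lemma summable_contourTerm (s : ℂ) (κ : ℕ) {b : ℕ → ℂ} (hb : Conv b) {x : ℂ} (hx : ‖x‖ < 1)
    {t u : ℝ} (ht : t ∈ Set.Ioo (0 : ℝ) 1) (hu : u ∈ Set.Ioo (0 : ℝ) 1) :
    Summable (contourTerm s κ b x t u) := by
  have ht0 := ht.1
  have hu0 := hu.1
  refine .of_norm_bounded ((summable_majorant s hb hx).mul_left
    (t ^ (2 * κ + 1) * u ^ (2 * κ + 1))⁻¹) fun i => ?_
  rw [le_inv_mul_iff₀ (by positivity)]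
  exact norm_contourTerm_mul_le s κ b x ht.1.le ht.2.le hu.1.le hu.2.le i

lemma hasSum_contourTerm (s : ℂ) (κ : ℕ) {b : ℕ → ℂ} (hb : Conv b) {x : ℂ} (hx : ‖x‖ < 1) {t u : ℝ}
    (ht : t ∈ Set.Ioo (0 : ℝ) 1) (hu : u ∈ Set.Ioo (0 : ℝ) 1) {G : ℂ}
    (hG : HasSum (fun m : ℕ => b m * (x * t * u) ^ m * kernelSum (2 * (κ + 1 : ℕ) - s + m)
      (2 * (κ + 1 : ℕ) + s + m) (x * (1 - t) * (1 - u))) G) :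
    HasSum (contourTerm s κ b x t u) G := by
  have hsum := summable_contourTerm s κ hb hx ht hu
  have h := hsum.hasSum.prod_fiberwise fun m => (hsum.prod_factor m).hasSum
  have : G = ∑' i, contourTerm s κ b x t u i := by
    refine hG.unique (h.congr_fun fun m => ?_)
    rw [kernelSum, ← tsum_mul_left]
    refine tsum_congr fun p => ?_
    simp only [contourTerm, contourCoeff]
    push_cast
    simp only [mul_pow]
    ring
  rw [this]
  exact hsum.hasSum

lemma rpow_level (κ m : ℕ) {t : ℝ} (ht : 0 < t) :
    t ^ (2 * ((κ + 1 : ℕ) : ℝ) - 1) * t ^ m = t ^ ((2 * ((κ + 1 : ℕ) : ℝ) + m) - 1) := by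
  rw [← Real.rpow_natCast, ← Real.rpow_add ht]
  ring_nf

lemma rpow_level' (κ m : ℕ) {u : ℝ} (hu : 0 < u) :
    u ^ (2 * ((κ + 1 : ℕ) : ℝ) - 3 / 2) * u ^ m
      = u ^ ((2 * ((κ + 1 : ℕ) : ℝ) - 1 / 2 + m) - 1) := by
  rw [← Real.rpow_natCast, ← Real.rpow_add hu]
  ring_nf

lemma rpow_level_eq_pow (κ : ℕ) (t : ℝ) : t ^ (2 * ((κ + 1 : ℕ) : ℝ) - 1) = t ^ (2 * κ + 1) := by
  rw [← Real.rpow_natCast]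
  push_cast
  ring_nf

lemma rpow_level_eq_pow' (κ : ℕ) {u : ℝ} (hu : 0 < u) :
    u ^ (2 * ((κ + 1 : ℕ) : ℝ) - 3 / 2) = u ^ (2 * κ + 1) * u ^ (-1 / 2 : ℝ) := by
  rw [← Real.rpow_natCast, ← Real.rpow_add hu]
  push_cast
  ring_nf

lemma continuousOn_rpow_mul (a : ℝ) (p : ℕ) (c : ℂ) :
    ContinuousOn (fun u : ℝ => c * ((u ^ a * (1 - u) ^ p : ℝ) : ℂ)) (Set.Ioo 0 1) := by
  refine continuousOn_const.mul (Complex.continuous_ofReal.comp_continuousOn ?_)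
  refine ContinuousOn.mul (continuousOn_id.rpow_const fun x hx => Or.inl hx.1.ne') ?_
  fun_prop

lemma intervalIntegrable_rpow_neg_half :
    IntervalIntegrable (fun u : ℝ => u ^ (-1 / 2 : ℝ)) volume 0 1 :=
  intervalIntegral.intervalIntegrable_rpow' (by norm_num)

/-- Term-by-term evaluation of the `u`- and `t`-integrals of the double series. -/
lemma double_integral_contourTerm (s : ℂ) (κ : ℕ) {b : ℕ → ℂ} (hb : Conv b) {x : ℂ} (hx : ‖x‖ < 1)
    {G : ℝ → ℝ → ℂ}
    (hG : ∀ t ∈ Set.Ioo (0 : ℝ) 1, ∀ u ∈ Set.Ioo (0 : ℝ) 1,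
      HasSum (contourTerm s κ b x t u) (G t u)) :
    (∀ t ∈ Set.Ioo (0 : ℝ) 1, IntervalIntegrable
      (fun u => ((u ^ (2 * ((κ + 1 : ℕ) : ℝ) - 3 / 2) : ℝ) : ℂ) * G t u) volume 0 1) ∧
    IntervalIntegrable (fun t => ((t ^ (2 * ((κ + 1 : ℕ) : ℝ) - 1) : ℝ) : ℂ) *
      ∫ u in (0 : ℝ)..1, ((u ^ (2 * ((κ + 1 : ℕ) : ℝ) - 3 / 2) : ℝ) : ℂ) * G t u) volume 0 1 ∧
    HasSum (fun i : ℕ × ℕ => b i.1 * x ^ (i.1 + i.2) * kern s κ i.1 i.2)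
      (∫ t in (0 : ℝ)..1, ((t ^ (2 * ((κ + 1 : ℕ) : ℝ) - 1) : ℝ) : ℂ) *
        ∫ u in (0 : ℝ)..1, ((u ^ (2 * ((κ + 1 : ℕ) : ℝ) - 3 / 2) : ℝ) : ℂ) * G t u) := by
  have hM := summable_majorant s hb hx
  set D : ℝ → ℕ × ℕ → ℂ := fun t i =>
    b i.1 * x ^ (i.1 + i.2) * contourCoeff s κ i.1 i.2 * ((t ^ i.1 * (1 - t) ^ i.2 : ℝ) : ℂ) with hD
  set U : ℕ × ℕ → ℝ → ℝ := fun i u =>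
    u ^ ((2 * ((κ + 1 : ℕ) : ℝ) - 1 / 2 + i.1) - 1) * (1 - u) ^ i.2 with hU
  have hDU : ∀ t, ∀ u ∈ Set.Ioo (0 : ℝ) 1, ∀ i, ((u ^ (2 * ((κ + 1 : ℕ) : ℝ) - 3 / 2) : ℝ) : ℂ) *
      contourTerm s κ b x t u i = D t i * (U i u : ℂ) := fun t u hu i => by
    simp only [hD, hU, ← rpow_level' κ i.1 hu.1, contourTerm]
    push_cast
    ring
  -- The weight `u ^ (2k - 3/2)` falls short of the power `u ^ (2κ + 1)` in the majorant by `u ^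
  -- (-1/2)`, which is integrable.
  have hbd : ∀ t ∈ Set.Ioo (0 : ℝ) 1, ∀ i, ∀ u ∈ Set.Ioo (0 : ℝ) 1,
      ‖D t i * (U i u : ℂ)‖ ≤ ((t ^ (2 * κ + 1))⁻¹ * majorant s b x i) * u ^ (-1 / 2 : ℝ) := by
    intro t ht i u hu
    have ht0 := ht.1
    have hu0 := hu.1
    have h := norm_contourTerm_mul_le s κ b x ht.1.le ht.2.le hu.1.le hu.2.le i
    rw [← hDU t u hu i, norm_mul, Complex.norm_real, Real.norm_of_nonneg (by positivity),
      rpow_level_eq_pow' κ hu.1, mul_assoc, mul_comm (u ^ (-1 / 2 : ℝ)), ← mul_assoc]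
    refine mul_le_mul_of_nonneg_right ?_ (by positivity)
    rw [le_inv_mul_iff₀ (by positivity), ← mul_assoc]
    exact h
  have hu := fun t (ht : t ∈ Set.Ioo (0 : ℝ) 1) => hasSum_integral_of_product_bound
    (F := fun i u => D t i * (U i u : ℂ))
    (f := fun u => ((u ^ (2 * ((κ + 1 : ℕ) : ℝ) - 3 / 2) : ℝ) : ℂ) * G t u)
    (hM.mul_left _) intervalIntegrable_rpow_neg_half
    (fun i => continuousOn_rpow_mul _ _ _) (hbd t ht)
    (fun u hu => ((hG t ht u hu).mul_left _).congr_fun fun i => (hDU t u hu i).symm)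
  set V : ℕ × ℕ → ℂ := fun i => ∫ u in (0 : ℝ)..1, (U i u : ℂ) with hV
  have hVeq : ∀ i, V i = i.2.factorial / rise (2 * (κ + 1 : ℕ) - 1 / 2 + i.1) (i.2 + 1) := fun i => by
    simp only [hV, hU]
    have hpos : (0 : ℝ) < 2 * ((κ + 1 : ℕ) : ℝ) - 1 / 2 + i.1 := by
      have h1 : (0 : ℝ) ≤ κ := κ.cast_nonneg
      have h2 : (0 : ℝ) ≤ i.1 := i.1.cast_nonneg
      push_cast
      linarith
    rw [integral_rpow_mul_one_sub_pow hpos i.2]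
    push_cast
    rfl
  set J : ℝ := ∫ u in (0 : ℝ)..1, u ^ (-1 / 2 : ℝ)
  have hDV : ∀ t ∈ Set.Ioo (0 : ℝ) 1, ∀ i,
      ‖D t i * V i‖ ≤ ((t ^ (2 * κ + 1))⁻¹ * majorant s b x i) * J := by
    intro t ht i
    rw [hV, ← intervalIntegral.integral_const_mul, ← intervalIntegral.integral_const_mul]
    refine intervalIntegral.norm_integral_le_of_norm_le zero_le_one ?_
      (intervalIntegrable_rpow_neg_half.const_mul _)
    have : ∀ᵐ u : ℝ, u ≠ 1 := by simp [ae_iff]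
    filter_upwards [this] with u hu1 hu
    exact hbd t ht i u ⟨hu.1, lt_of_le_of_ne hu.2 hu1⟩
  set E : ℕ × ℕ → ℂ := fun i => b i.1 * x ^ (i.1 + i.2) * contourCoeff s κ i.1 i.2 * V i with hE
  set T : ℕ × ℕ → ℝ → ℝ := fun i t =>
    t ^ ((2 * ((κ + 1 : ℕ) : ℝ) + i.1) - 1) * (1 - t) ^ i.2 with hT
  have hET : ∀ t ∈ Set.Ioo (0 : ℝ) 1, ∀ i, E i * (T i t : ℂ)
      = ((t ^ (2 * ((κ + 1 : ℕ) : ℝ) - 1) : ℝ) : ℂ) * (D t i * V i) := fun t ht i => by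
    simp only [hD, hE, hT, ← rpow_level κ i.1 ht.1]
    push_cast
    ring
  -- The weight `t ^ (2k - 1)` cancels `(t ^ (2κ + 1))⁻¹` exactly, so the majorant is constant in
  -- `t`.
  have ht := hasSum_integral_of_product_bound
    (F := fun i t => E i * (T i t : ℂ))
    (f := fun t => ((t ^ (2 * ((κ + 1 : ℕ) : ℝ) - 1) : ℝ) : ℂ) *
      ∫ u in (0 : ℝ)..1, ((u ^ (2 * ((κ + 1 : ℕ) : ℝ) - 3 / 2) : ℝ) : ℂ) * G t u)
    (hM.mul_right J) (g := fun _ => 1) intervalIntegrable_const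
    (fun i => continuousOn_rpow_mul _ _ _)
    (fun i t ht => by
      have ht0 := ht.1
      rw [hET t ht i, norm_mul, Complex.norm_real, Real.norm_of_nonneg (by positivity),
        rpow_level_eq_pow, mul_one, ← le_inv_mul_iff₀ (by positivity), ← mul_assoc]
      exact hDV t ht i)
    (fun t ht => by
      have h := (hu t ht).2
      simp only [intervalIntegral.integral_const_mul] at h
      exact (h.mul_left _).congr_fun fun i => hET t ht i)
  refine ⟨fun t ht => (hu t ht).1, ht.1, ht.2.congr_fun fun i => ?_⟩
  rw [intervalIntegral.integral_const_mul]
  simp only [hT]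
  rw [integral_rpow_mul_one_sub_pow (by push_cast; positivity) i.2]
  simp only [hE, hVeq, kern, contourCoeff]
  have : (i.2.factorial : ℂ) ≠ 0 := by exact_mod_cast i.2.factorial_ne_zero
  push_cast
  field_simp

/-! ### Taylor coefficients of the nested integrals -/

/-- The Taylor coefficients at `0` of the nested integral of level `k`. -/
noncomputable def nestCoeff (α : ℝ) (s : ℂ) : ℕ → ℕ → ℂ
  | 0 => fun n => rise (-s) n * rise s n / (n.factorial * rise (1 / 2) n)
  | κ + 1 => fun n => ∑ ij ∈ Finset.HasAntidiagonal.antidiagonal n,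
      eulerFactor α (κ + 1) ij.1 * nestCoeff α s κ ij.1 * kern s κ ij.1 ij.2

lemma hasSum_antidiagonal {f : ℕ × ℕ → ℂ} {S : ℂ} (h : HasSum f S) :
    HasSum (fun n => ∑ ij ∈ Finset.HasAntidiagonal.antidiagonal n, f ij) S := by
  refine ((Finset.HasAntidiagonal.sigmaAntidiagonalEquivProd.hasSum_iff).mpr h).sigma fun n => ?_
  rw [← Finset.sum_coe_sort]
  exact hasSum_fintype _

lemma rise_half_ne_zero (n : ℕ) : rise (1 / 2) n ≠ 0 := by
  refine Finset.prod_ne_zero_iff.mpr fun j _ h => ?_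
  have : ((1 / 2 + j : ℝ) : ℂ) = 0 := by push_cast; exact h
  rw [Complex.ofReal_eq_zero] at this
  have : (0 : ℝ) < 1 / 2 + j := by positivity
  linarith

lemma hypergeometric_term (α : ℝ) (s x : ℂ) (n : ℕ) :
    (ordinaryHypergeometricSeries ℂ (-s) s (1 / 2 : ℂ) n fun _ => x)
      = nestCoeff α s 0 n * x ^ n := by
  rw [ordinaryHypergeometricSeries_apply_eq, ← rise_eq_ascPochhammer_eval,
    ← rise_eq_ascPochhammer_eval, ← rise_eq_ascPochhammer_eval, nestCoeff, smul_eq_mul]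
  have := rise_half_ne_zero n
  have : (n.factorial : ℂ) ≠ 0 := by exact_mod_cast n.factorial_ne_zero
  field_simp

lemma conv_nestCoeff_zero (α : ℝ) (s : ℂ) : Conv (nestCoeff α s 0) := by
  intro x hx
  have hr : 1 ≤ (ordinaryHypergeometricSeries ℂ (-s) s (1 / 2 : ℂ)).radius := by
    -- Either the radius is `1`, or an upper parameter is a nonpositive integer and the series
    -- terminates; the lower parameter `1/2` is never one.
    by_cases h : ∀ k : ℕ, (k : ℂ) ≠ - -s ∧ (k : ℂ) ≠ -s ∧ (k : ℂ) ≠ -(1 / 2)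
    · exact (ordinaryHypergeometricSeries_radius_eq_one ℂ _ _ _ h).ge
    · push Not at h
      obtain ⟨k, hk⟩ := h
      by_cases h1 : (k : ℂ) = - -s
      · rw [show -s = -(k : ℂ) by rw [h1, neg_neg], ordinaryHypergeometric_radius_top_of_neg_nat₁]
        exact le_top
      · by_cases h2 : (k : ℂ) = -s
        · rw [show ordinaryHypergeometricSeries ℂ (-s) s (1 / 2 : ℂ)
              = ordinaryHypergeometricSeries ℂ (-s) (-(k : ℂ)) (1 / 2 : ℂ) by rw [h2, neg_neg],
            ordinaryHypergeometric_radius_top_of_neg_nat₂]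
          exact le_top
        · have h3 := congrArg Complex.re (hk h1 h2)
          norm_num at h3
          have : (0 : ℝ) ≤ k := k.cast_nonneg
          linarith
  have hmem : x ∈ Metric.eball (0 : ℂ) (ordinaryHypergeometricSeries ℂ (-s) s (1 / 2 : ℂ)).radius := by
    refine Metric.eball_subset_eball hr ?_
    rwa [Metric.mem_eball, edist_zero_right, ← ofReal_norm, ENNReal.ofReal_lt_one]
  exact (FormalMultilinearSeries.summable _ hmem).congr fun n => hypergeometric_term α s x n

lemma hypergeometric_eq_psum (α : ℝ) (s x : ℂ) :
    ordinaryHypergeometric (-s) s (1 / 2 : ℂ) x = psum (nestCoeff α s 0) x :=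
  tsum_congr fun n => hypergeometric_term α s x n

lemma hasSum_nestCoeff_succ (α : ℝ) (s : ℂ) (κ : ℕ) {x : ℂ} {S : ℂ}
    (h : HasSum (fun i : ℕ × ℕ => eulerFactor α (κ + 1) i.1 * nestCoeff α s κ i.1 *
      x ^ (i.1 + i.2) * kern s κ i.1 i.2) S) :
    HasSum (fun n => nestCoeff α s (κ + 1) n * x ^ n) S := by
  refine (hasSum_antidiagonal h).congr_fun fun n => ?_
  rw [nestCoeff, Finset.sum_mul]
  refine Finset.sum_congr rfl fun ij hij => ?_
  rw [Finset.HasAntidiagonal.mem_antidiagonal.mp hij]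
  ring

lemma conv_nestCoeff (α : ℝ) (s : ℂ) (κ : ℕ) : Conv (nestCoeff α s κ) := by
  induction κ with
  | zero => exact conv_nestCoeff_zero α s
  | succ κ ih =>
    intro x hx
    -- Here `G` is the sum of the double series itself, so convergence is obtained without any
    -- choice of contour.
    exact (hasSum_nestCoeff_succ α s κ (double_integral_contourTerm s κ
      (ih.eulerFactor_mul α (κ + 1)) hx fun t ht u hu =>
        (summable_contourTerm s κ (ih.eulerFactor_mul α (κ + 1)) hx ht hu).hasSum).2.2).summable

lemma contourIntegrand_eq {ρ α h : ℝ} {k : ℕ} {a : ℕ → ℂ} {f : ℂ → ℂ} (ha : Conv a)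
    (hf : ∀ w : ℂ, 0 < ‖w‖ → ‖w‖ < 1 → f w = psum a w) {x : ℂ} (hx : 0 < ‖x‖) {t u R : ℝ}
    (ht : 0 < t) (hu : 0 < u) (hR : 1 < R) (hX : ‖x * (1 - t) * (1 - u)‖ * R < 1)
    (hw : ∀ v : ℂ, ‖v‖ = R → ‖innerVar x t u v‖ < 1) {v : ℂ} (hv : ‖v‖ = R) :
    contourIntegrand ρ α h k f x t u v = 1 / v * ((v - 1) / v) ^ (-deltaMinus ρ h k) *
      (1 - x * (1 - t) * (1 - u) * v) ^ (-deltaPlus ρ h k) *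
      psum (fun m => eulerFactor α k m * a m)
        (v / (v - 1) * (x * t * u / (1 - x * (1 - t) * (1 - u) * v))) := by
  have e : innerVar x t u v = v / (v - 1) * (x * t * u / (1 - x * (1 - t) * (1 - u) * v)) := by
    rw [innerVar]
    ring_nf
  have h1 := one_sub_inv_mem hR hv
  have h2 := Complex.slitPlane_ne_zero (one_sub_mul_mem hX hv).2
  have h3 : v - 1 ≠ 0 := fun h => Complex.slitPlane_ne_zero h1.2.2.2 (by rw [h, zero_div])
  have hpos : 0 < ‖innerVar x t u v‖ := by
    rw [norm_pos_iff, e]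
    have : (t : ℂ) ≠ 0 := by exact_mod_cast ht.ne'
    have : (u : ℂ) ≠ 0 := by exact_mod_cast hu.ne'
    have := norm_pos_iff.mp hx
    have := h1.1
    positivity
  rw [contourIntegrand, eulerOp_eq_psum ha hf hpos (hw v hv), e]

/-- One step of the nested integral, in terms of power series. -/
lemma level_step {ρ α h : ℝ} {κ : ℕ} {a : ℕ → ℂ} {f : ℂ → ℂ} (ha : Conv a)
    (hf : ∀ w : ℂ, 0 < ‖w‖ → ‖w‖ < 1 → f w = psum a w) {r : ℂ → ℝ → ℝ → ℝ} {x : ℂ} (hx0 : 0 < ‖x‖)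
    (hx : ‖x‖ < 1)
    (hr : ∀ t u : ℝ, t ∈ Set.Ioo (0 : ℝ) 1 → u ∈ Set.Ioo (0 : ℝ) 1 →
      1 < r x t u ∧ ‖x‖ * (1 - t) * (1 - u) * r x t u < 1 ∧
        ∀ v : ℂ, ‖v‖ = r x t u → ‖innerVar x t u v‖ < 1) :
    (∀ t ∈ Set.Ioo (0 : ℝ) 1, ∀ u ∈ Set.Ioo (0 : ℝ) 1,
      CircleIntegrable (contourIntegrand ρ α h (κ + 1) f x t u) 0 (r x t u)) ∧
    (∀ t ∈ Set.Ioo (0 : ℝ) 1,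
      IntervalIntegrable (uIntegrand ρ α h (κ + 1) r f x t) volume 0 1) ∧
    IntervalIntegrable (tIntegrand ρ α h (κ + 1) r f x) volume 0 1 ∧
    HasSum (fun i : ℕ × ℕ => eulerFactor α (κ + 1) i.1 * a i.1 * x ^ (i.1 + i.2) *
      kern (sigma ρ h) κ i.1 i.2) (∫ t in (0 : ℝ)..1, tIntegrand ρ α h (κ + 1) r f x t) := by
  have hb := ha.eulerFactor_mul α (κ + 1)
  have hcirc : ∀ t ∈ Set.Ioo (0 : ℝ) 1, ∀ u ∈ Set.Ioo (0 : ℝ) 1,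
      CircleIntegrable (contourIntegrand ρ α h (κ + 1) f x t u) 0 (r x t u) ∧
      HasSum (contourTerm (sigma ρ h) κ (fun m => eulerFactor α (κ + 1) m * a m) x t u)
        (1 / (2 * Real.pi * Complex.I) *
          ∮ v in C(0, r x t u), contourIntegrand ρ α h (κ + 1) f x t u v) := by
    intro t ht u hu
    obtain ⟨hR, hX', hw⟩ := hr t u ht hu
    have hR0 : 0 < r x t u := by linarith
    have hX : ‖x * (1 - t) * (1 - u)‖ * r x t u < 1 := by
      have e1 : ‖(1 - t : ℂ)‖ = 1 - t := by
        rw [← Complex.ofReal_one, ← Complex.ofReal_sub, Complex.norm_real,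
          Real.norm_of_nonneg (by linarith [ht.2])]
      have e2 : ‖(1 - u : ℂ)‖ = 1 - u := by
        rw [← Complex.ofReal_one, ← Complex.ofReal_sub, Complex.norm_real,
          Real.norm_of_nonneg (by linarith [hu.2])]
      rwa [norm_mul, norm_mul, e1, e2]
    have heq := fun v (hv : ‖v‖ = r x t u) =>
      contourIntegrand_eq (ρ := ρ) (α := α) (h := h) (k := κ + 1) ha hf hx0 ht.1 hu.1 hR hX hw hv
    have hp := circleIntegral_psum hb (deltaMinus ρ h (κ + 1)) (deltaPlus ρ h (κ + 1))
      (x * t * u) hR hX (fun v hv => by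
        have := hw v hv
        rw [innerVar] at this
        convert this using 5
        ring)
    constructor
    · refine (circleIntegrable_congr fun v hv => ?_).mpr hp.1
      exact heq v (by simpa [abs_of_pos hR0] using hv)
    · refine hasSum_contourTerm _ κ hb hx ht hu ?_
      rw [circleIntegral.integral_congr hR0.le fun v hv => heq v (by simpa using hv)]
      exact hp.2
  obtain ⟨h1, h2, h3⟩ := double_integral_contourTerm (sigma ρ h) κ hb hx
    fun t ht u hu => (hcirc t ht u hu).2
  exact ⟨fun t ht u hu => (hcirc t ht u hu).1, h1, h2, h3⟩

lemma nestedIntegral_eq_psum {ρ α h : ℝ} {r : ℕ → ℂ → ℝ → ℝ → ℝ} (hr : AdmissibleRadii r) (n : ℕ) :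
    ∀ x : ℂ, 0 < ‖x‖ → ‖x‖ < 1 →
      nestedIntegral ρ α h r n x = psum (nestCoeff α (sigma ρ h) n) x := by
  induction n with
  | zero =>
    intro x _ _
    rw [← hypergeometric_eq_psum, nestedIntegral, deltaMinus, deltaPlus]
    simp
  | succ n ih =>
    intro x hx0 hx
    exact (hasSum_nestCoeff_succ α _ n (level_step (κ := n) (conv_nestCoeff α _ n) ih hx0 hx
      fun t u ht hu => hr (n + 1) x t u hx ht hu).2.2.2).tsum_eq.symm

/-! ### Existence of admissible radii -/

/-- Take `‖x‖ < Y < 1`, `q = √(Y(1 - t)(1 - u))`, `d = √(Y t u)` and `R = 1 / q`. Then `‖v - 1‖ ≥ (1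
- q) / q` and the other denominator is at least `1 - q`, so `‖w‖ ≤ (d / (1 - q))²`, and it remains
to see `q + d < 1`. Using `Y` in place of `‖x‖` keeps `R` finite at `x = 0`. -/
lemma exists_admissibleRadii : ∃ r, AdmissibleRadii r := by
  refine ⟨fun _ x t u => (√((1 + ‖x‖) / 2 * ((1 - t) * (1 - u))))⁻¹, ?_⟩
  intro k x t u hx ht hu
  obtain ⟨ht0, ht1⟩ := ht
  obtain ⟨hu0, hu1⟩ := hu
  have ht' : 0 < 1 - t := by linarith
  have hu' : 0 < 1 - u := by linarith
  set Y := (1 + ‖x‖) / 2 with hY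
  have hY0 : 0 < Y := by positivity
  have hY1 : Y < 1 := by rw [hY]; linarith
  have hxY : ‖x‖ < Y := by rw [hY]; linarith
  set q := √(Y * ((1 - t) * (1 - u))) with hq
  have hq2 : q ^ 2 = Y * ((1 - t) * (1 - u)) := Real.sq_sqrt (by positivity)
  have hq0 : 0 < q := Real.sqrt_pos.mpr (by positivity)
  set d := √(Y * (t * u)) with hd
  have hd2 : d ^ 2 = Y * (t * u) := Real.sq_sqrt (by positivity)
  have hd0 : 0 < d := Real.sqrt_pos.mpr (by positivity)
  -- By the inequality of arithmetic and geometric means, `√((1 - t)(1 - u)) + √(t u) ≤ 1`, hence `q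
  -- + d ≤ √Y`.
  have hqd : q + d < 1 := by
    set y := √Y
    have hy1 : y < 1 := by rw [Real.sqrt_lt' one_pos]; simpa using hY1
    have hy0 : 0 ≤ y := Real.sqrt_nonneg _
    have hyY : y ^ 2 = Y := Real.sq_sqrt hY0.le
    have h1 : q ≤ y * ((1 - t + (1 - u)) / 2) := by
      apply le_of_sq_le_sq _ (by positivity)
      rw [hq2, mul_pow, hyY]
      gcongr
      nlinarith [sq_nonneg (t - u)]
    have h2 : d ≤ y * ((t + u) / 2) := by
      apply le_of_sq_le_sq _ (by positivity)
      rw [hd2, mul_pow, hyY]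
      gcongr
      nlinarith [sq_nonneg (t - u)]
    nlinarith
  have hq1 : q < 1 := by linarith
  have hxq : ‖x‖ * (1 - t) * (1 - u) * q⁻¹ ≤ q := by
    rw [← div_eq_mul_inv, div_le_iff₀ hq0, ← sq, hq2, mul_assoc]
    gcongr
  refine ⟨(one_lt_inv₀ hq0).mpr hq1, hxq.trans_lt hq1, fun v hv => ?_⟩
  have hv1 : q⁻¹ - 1 ≤ ‖v - 1‖ := by
    have := norm_sub_norm_le v 1
    rwa [hv, norm_one] at this
  have e1 : ‖(1 - t : ℂ)‖ = 1 - t := by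
    rw [← Complex.ofReal_one, ← Complex.ofReal_sub, Complex.norm_real, Real.norm_of_nonneg ht'.le]
  have e2 : ‖(1 - u : ℂ)‖ = 1 - u := by
    rw [← Complex.ofReal_one, ← Complex.ofReal_sub, Complex.norm_real, Real.norm_of_nonneg hu'.le]
  have hv2 : 1 - q ≤ ‖1 - x * v * (1 - t) * (1 - u)‖ := by
    have := norm_sub_norm_le (1 : ℂ) (x * v * (1 - t) * (1 - u))
    rw [norm_one, norm_mul, norm_mul, norm_mul, e1, e2, hv] at this
    refine le_trans ?_ this
    have e : ‖x‖ * q⁻¹ * (1 - t) * (1 - u) = ‖x‖ * (1 - t) * (1 - u) * q⁻¹ := by ring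
    rw [e]
    linarith
  have hq3 : 0 < q⁻¹ - 1 := by
    have := (one_lt_inv₀ hq0).mpr hq1
    linarith
  have hq4 : 0 < 1 - q := by linarith
  have hnum : ‖x * t * u‖ ≤ d ^ 2 := by
    rw [hd2, norm_mul, norm_mul, Complex.norm_real, Complex.norm_real, Real.norm_of_nonneg ht0.le,
      Real.norm_of_nonneg hu0.le, mul_assoc]
    gcongr
  rw [innerVar, norm_mul, norm_div, norm_div, hv]
  calc q⁻¹ / ‖v - 1‖ * (‖x * t * u‖ / ‖1 - x * v * (1 - t) * (1 - u)‖)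
      ≤ q⁻¹ / (q⁻¹ - 1) * (d ^ 2 / (1 - q)) := by gcongr
    _ = (d / (1 - q)) ^ 2 := by
      have : q⁻¹ - 1 = (1 - q) / q := by field_simp
      rw [this]
      field_simp
    _ < 1 := by
      refine pow_lt_one₀ (by positivity) ?_ two_ne_zero
      rw [div_lt_one hq4]
      linarith

/-! ### Recurrences and the splitting into levels -/

lemma rise_ofReal_ne_zero {a : ℝ} (ha : 0 < a) (p : ℕ) : rise a p ≠ 0 := by
  refine Finset.prod_ne_zero_iff.mpr fun j _ h => ?_
  have h1 : ((a + j : ℝ) : ℂ) = 0 := by push_cast; exact h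
  rw [Complex.ofReal_eq_zero] at h1
  have : (0 : ℝ) ≤ j := j.cast_nonneg
  linarith

lemma rise_level_ne_zero (κ m p : ℕ) :
    rise (2 * (κ + 1 : ℕ) + m) p ≠ 0 ∧ rise (2 * (κ + 1 : ℕ) - 1 / 2 + m) p ≠ 0 := by
  have h1 : (0 : ℝ) ≤ κ := κ.cast_nonneg
  have h2 : (0 : ℝ) ≤ m := m.cast_nonneg
  have h3 := rise_ofReal_ne_zero (a := 2 * (κ + 1 : ℕ) + m) (by push_cast; linarith) p
  have h4 := rise_ofReal_ne_zero (a := 2 * (κ + 1 : ℕ) - 1 / 2 + m) (by push_cast; linarith) p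
  push_cast at h3 h4 ⊢
  exact ⟨h3, h4⟩

lemma kern_zero (s : ℂ) (κ m : ℕ) :
    ((2 * (κ + 1 : ℕ) + m) * (2 * (κ + 1 : ℕ) - 1 / 2 + m)) * kern s κ m 0 = 1 := by
  obtain ⟨h1, h2⟩ := rise_level_ne_zero κ m 1
  simp only [kern, zero_add]
  simp only [rise, Finset.prod_range_one, Finset.prod_range_zero, Nat.cast_zero, add_zero] at *
  rw [mul_one, mul_one_div, div_self (mul_ne_zero h1 h2)]

/-- Together with `kern_zero` this says that `kern s κ m` is the response of the hypergeometric
recurrence, shifted by `2(κ + 1)`, to a unit source at index `m`. -/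
lemma kern_succ (s : ℂ) (κ m p : ℕ) :
    ((2 * (κ + 1 : ℕ) + m + (p + 1 : ℕ)) * (2 * (κ + 1 : ℕ) - 1 / 2 + m + (p + 1 : ℕ)))
      * kern s κ m (p + 1) = ((2 * (κ + 1 : ℕ) + m + p) ^ 2 - s ^ 2) * kern s κ m p := by
  obtain ⟨h1, h2⟩ := rise_level_ne_zero κ m (p + 1)
  obtain ⟨h3, h4⟩ := rise_level_ne_zero κ m (p + 2)
  rw [rise_succ] at h3 h4
  simp only [kern, rise_succ _ (p + 1), rise_succ (_ - s + _) p, rise_succ (_ + s + _) p]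
  have h5 := right_ne_zero_of_mul h3
  have h6 := right_ne_zero_of_mul h4
  have e : (2 * (κ + 1 : ℕ) + m + p : ℂ) ^ 2 - s ^ 2
      = (2 * (κ + 1 : ℕ) - s + m + p) * (2 * (κ + 1 : ℕ) + s + m + p) := by ring
  rw [e]
  generalize (2 * (κ + 1 : ℕ) + m + (p + 1 : ℕ) : ℂ) = F₁ at h5 ⊢
  generalize (2 * (κ + 1 : ℕ) - 1 / 2 + m + (p + 1 : ℕ) : ℂ) = F₂ at h6 ⊢
  generalize rise (2 * (κ + 1 : ℕ) + m) (p + 1) = R₁ at h1 ⊢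
  generalize rise (2 * (κ + 1 : ℕ) - 1 / 2 + m) (p + 1) = R₂ at h2 ⊢
  field_simp

lemma nestCoeff_zero_recurrence (α : ℝ) (s : ℂ) (n : ℕ) :
    ((n + 1 : ℕ) * ((n : ℂ) + 1 / 2)) * nestCoeff α s 0 (n + 1)
      = ((n : ℂ) ^ 2 - s ^ 2) * nestCoeff α s 0 n := by
  have h1 := rise_half_ne_zero n
  have h2 := rise_half_ne_zero (n + 1)
  rw [rise_succ] at h2
  have h3 := right_ne_zero_of_mul h2
  have h4 : (n.factorial : ℂ) ≠ 0 := by exact_mod_cast n.factorial_ne_zero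
  have h5 : ((n + 1 : ℕ) : ℂ) ≠ 0 := by exact_mod_cast n.succ_ne_zero
  simp only [nestCoeff, rise_succ, Nat.factorial_succ, add_comm (n : ℂ) (1 / 2)]
  generalize (1 / 2 + n : ℂ) = c at h3 ⊢
  push_cast at h5 ⊢
  field_simp
  ring

lemma nestCoeff_succ_zero (α : ℝ) (s : ℂ) (κ : ℕ) :
    (2 * (κ + 1 : ℕ) * (2 * (κ + 1 : ℕ) - 1 / 2)) * nestCoeff α s (κ + 1) 0
      = eulerFactor α (κ + 1) 0 * nestCoeff α s κ 0 := by
  have h := kern_zero s κ 0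
  rw [Nat.cast_zero, add_zero, add_zero] at h
  simp only [nestCoeff]
  rw [Finset.HasAntidiagonal.antidiagonal_zero, Finset.sum_singleton, mul_left_comm, h, mul_one]

/-- In the convolution at `n + 1` the term with `p = 0` yields the new source, and `kern_succ`
reduces all others to the convolution at `n`. -/
lemma nestCoeff_succ_recurrence (α : ℝ) (s : ℂ) (κ n : ℕ) :
    ((n + 1 + 2 * (κ + 1 : ℕ)) * (n + 1 + 2 * (κ + 1 : ℕ) - 1 / 2)) * nestCoeff α s (κ + 1) (n + 1)
      = ((n + 2 * (κ + 1 : ℕ) : ℂ) ^ 2 - s ^ 2) * nestCoeff α s (κ + 1) n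
        + eulerFactor α (κ + 1) (n + 1) * nestCoeff α s κ (n + 1) := by
  have h0 := kern_zero s κ (n + 1)
  simp only [nestCoeff]
  rw [Finset.Nat.sum_antidiagonal_succ', mul_add, add_comm, Finset.mul_sum, Finset.mul_sum]
  congr 1
  · refine Finset.sum_congr rfl fun ij hij => ?_
    have h := kern_succ s κ ij.1 ij.2
    have hn : (n : ℂ) = ij.1 + ij.2 := by
      rw [← Finset.HasAntidiagonal.mem_antidiagonal.mp hij]; push_cast; rfl
    rw [hn]
    push_cast at h ⊢
    linear_combination (eulerFactor α (κ + 1) ij.1 * nestCoeff α s κ ij.1) * h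
  · push_cast at h0 ⊢
    linear_combination (eulerFactor α (κ + 1) (n + 1) * nestCoeff α s κ (n + 1)) * h0

/-- The contribution of level `k` to the coefficient of `ξ ^ N` of the Lamé series. -/
noncomputable def levelCoeff (ρ α : ℝ) (s : ℂ) (k N : ℕ) : ℂ :=
  if 2 * k ≤ N then
    nestCoeff α s k (N - 2 * k) * (1 + (ρ : ℂ) ^ 2) ^ (N - 2 * k) * (-(ρ : ℂ) ^ 2) ^ k
  else 0

lemma levelCoeff_add (ρ α : ℝ) (s : ℂ) (k n : ℕ) : levelCoeff ρ α s k (n + 2 * k) =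
    nestCoeff α s k n * (1 + (ρ : ℂ) ^ 2) ^ n * (-(ρ : ℂ) ^ 2) ^ k := by
  rw [levelCoeff, if_pos (by omega), Nat.add_sub_cancel]

lemma levelCoeff_of_lt {ρ α : ℝ} {s : ℂ} {k N : ℕ} (h : N < 2 * k) : levelCoeff ρ α s k N = 0 := by
  rw [levelCoeff, if_neg (by omega)]

lemma levelCoeff_zero_recurrence (ρ α : ℝ) (s : ℂ) (N : ℕ) :
    ((N : ℂ) + 2) * (N + 3 / 2) * levelCoeff ρ α s 0 (N + 2)
      = (1 + (ρ : ℂ) ^ 2) * ((N + 1) ^ 2 - s ^ 2) * levelCoeff ρ α s 0 (N + 1) := by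
  have e1 := levelCoeff_add ρ α s 0 (N + 2)
  have e2 := levelCoeff_add ρ α s 0 (N + 1)
  have h := nestCoeff_zero_recurrence α s (N + 1)
  simp only [mul_zero, add_zero, pow_zero, mul_one] at e1 e2
  rw [e1, e2]
  push_cast at h ⊢
  linear_combination ((1 + (ρ : ℂ) ^ 2) ^ (N + 2)) * h

lemma levelCoeff_succ_recurrence (ρ α : ℝ) (s : ℂ) (k N : ℕ) :
    ((N : ℂ) + 2) * (N + 3 / 2) * levelCoeff ρ α s (k + 1) (N + 2)
      = (1 + (ρ : ℂ) ^ 2) * ((N + 1) ^ 2 - s ^ 2) * levelCoeff ρ α s (k + 1) (N + 1)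
        + (-(ρ : ℂ) ^ 2) * ((N - α / 2) * (N + 1 / 2 + α / 2)) * levelCoeff ρ α s k N := by
  -- Before the level starts all terms vanish; at `N = 2k` only the source acts; afterwards the full
  -- recurrence holds. At `m = N - 2k` the factor `eulerFactor α (k + 1) m` equals `(N - α/2)(N +
  -- 1/2 + α/2)`.
  rcases lt_trichotomy N (2 * k) with hN | rfl | hN
  · rw [levelCoeff_of_lt (by omega), levelCoeff_of_lt (by omega), levelCoeff_of_lt hN]
    simp
  · have e1 := levelCoeff_add ρ α s (k + 1) 0
    have e2 := levelCoeff_add ρ α s k 0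
    have h := nestCoeff_succ_zero α s k
    rw [zero_add] at e1 e2
    rw [show 2 * k + 2 = 2 * (k + 1) by ring, e1, e2,
      levelCoeff_of_lt (show 2 * k + 1 < 2 * (k + 1) by omega)]
    simp only [eulerFactor] at h
    push_cast at h ⊢
    linear_combination ((-(ρ : ℂ) ^ 2) ^ (k + 1)) * h
  · obtain ⟨j, rfl⟩ : ∃ j, N = j + 1 + 2 * k := ⟨N - 1 - 2 * k, by omega⟩
    have e1 := levelCoeff_add ρ α s (k + 1) (j + 1)
    have e2 := levelCoeff_add ρ α s (k + 1) j
    have e3 := levelCoeff_add ρ α s k (j + 1)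
    have h := nestCoeff_succ_recurrence α s k j
    rw [show j + 1 + 2 * k + 2 = j + 1 + 2 * (k + 1) by ring, e1, e3,
      show j + 1 + 2 * k + 1 = j + 2 * (k + 1) by ring, e2]
    simp only [eulerFactor] at h
    push_cast at h ⊢
    linear_combination ((1 + (ρ : ℂ) ^ 2) ^ (j + 1) * (-(ρ : ℂ) ^ 2) ^ (k + 1)) * h

lemma sigma_sq (ρ h : ℝ) : sigma ρ h ^ 2 = ((h / (4 * (1 + ρ ^ 2)) : ℝ) : ℂ) := by
  rw [sigma]
  have := Complex.cpow_nat_inv_pow ((h / (4 * (1 + ρ ^ 2)) : ℝ) : ℂ) two_ne_zero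
  rw [one_div]
  exact_mod_cast this

lemma mul_sigma_sq (ρ h : ℝ) : (1 + (ρ : ℂ) ^ 2) * sigma ρ h ^ 2 = h / 4 := by
  have h0 : (1 + ρ ^ 2 : ℝ) ≠ 0 := by positivity
  have h1 : (1 + (ρ : ℂ) ^ 2) ≠ 0 := by exact_mod_cast h0
  rw [sigma_sq]
  push_cast
  field_simp

/-- Summing the level recurrences over `k` gives back the recurrence of `coeff`. An arbitrary cutoff
`K > N` lets the source sum, whose level index is lower by one, use the induction hypothesis. -/
lemma sum_levelCoeff (ρ α h : ℝ) (N : ℕ) :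
    ∀ K, N < K → ∑ k ∈ Finset.range K, levelCoeff ρ α (sigma ρ h) k N = coeff ρ α h N := by
  have hbase : ∀ N, N < 2 → ∀ K, N < K →
      ∑ k ∈ Finset.range K, levelCoeff ρ α (sigma ρ h) k N = levelCoeff ρ α (sigma ρ h) 0 N := by
    intro N hN K hK
    obtain ⟨K, rfl⟩ : ∃ K', K = K' + 1 := ⟨K - 1, by omega⟩
    rw [Finset.sum_range_succ', Finset.sum_eq_zero, zero_add]
    intro k _
    exact levelCoeff_of_lt (by omega)
  induction N using Nat.twoStepInduction with
  | zero =>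
    intro K hK
    rw [hbase 0 (by norm_num) K hK]
    simp [levelCoeff, nestCoeff, rise, coeff]
  | one =>
    intro K hK
    rw [hbase 1 (by norm_num) K hK]
    simp [levelCoeff, nestCoeff, rise, coeff]
    linear_combination (-2) * mul_sigma_sq ρ h
  | more N ih0 ih1 =>
    intro K hK
    obtain ⟨K, rfl⟩ : ∃ K', K = K' + 1 := ⟨K - 1, by omega⟩
    have h0 := ih0 K (by omega)
    have h1 := ih1 (K + 1) (by omega)
    have hrec := congrArg Complex.ofReal (coeff_recurrence ρ α h N)
    push_cast at hrec
    have hne : ((N : ℂ) + 2) * (N + 3 / 2) ≠ 0 := by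
      have : (((N : ℝ) + 2) * (N + 3 / 2) : ℝ) ≠ 0 := by positivity
      have := Complex.ofReal_ne_zero.mpr this
      push_cast at this
      exact this
    refine mul_left_cancel₀ hne ?_
    rw [Finset.sum_range_succ', mul_add, Finset.mul_sum, levelCoeff_zero_recurrence]
    simp only [levelCoeff_succ_recurrence, Finset.sum_add_distrib, ← Finset.mul_sum, h0]
    rw [Finset.sum_range_succ'] at h1
    linear_combination (1 + (ρ : ℂ) ^ 2) * ((N + 1) ^ 2 - sigma ρ h ^ 2) * h1 - hrec -
      (coeff ρ α h (N + 1) : ℂ) * mul_sigma_sq ρ h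

/-! ### Absolute convergence and summation over the levels -/

lemma summable_of_two_term_bound {D P Q : ℕ → ℝ} {p q : ℝ} (hD : ∀ n, 0 ≤ D n)
    (hP : Tendsto P atTop (𝓝 p)) (hQ : Tendsto Q atTop (𝓝 q)) (hq : 0 ≤ q)
    (hpq : p + q < 1)
    (h : ∀ n, D (n + 2) ≤ P n * D (n + 1) + Q n * D n) : Summable D := by
  -- The midpoint of `q` and `1 - p`. Since `p + μ < 1` and `q / μ < 1`, the combination `D (n + 1)
  -- + μ D n` eventually contracts by some `l < 1`.
  set μ := (1 - p + q) / 2 with hμ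
  have hμ0 : 0 < μ := by rw [hμ]; linarith
  have hμ1 : p + μ < 1 := by rw [hμ]; linarith
  have hμ2 : q / μ < 1 := by rw [div_lt_one hμ0, hμ]; linarith
  obtain ⟨l, hl, hl1⟩ := exists_between (max_lt hμ1 hμ2)
  have hlp : p < l - μ := by linarith [(le_max_left _ _).trans_lt hl]
  have hlq : q < l * μ := (div_lt_iff₀ hμ0).mp ((le_max_right _ _).trans_lt hl)
  have hY0 : ∀ n, 0 ≤ D (n + 1) + μ * D n := fun n => by
    have := hD n
    have := hD (n + 1)
    positivity
  have hY : Summable fun n => D (n + 1) + μ * D n := by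
    refine summable_of_ratio_norm_eventually_le hl1 ?_
    filter_upwards [hP.eventually (gt_mem_nhds hlp), hQ.eventually (gt_mem_nhds hlq)] with n h1 h2
    rw [Real.norm_of_nonneg (hY0 _), Real.norm_of_nonneg (hY0 _)]
    have := mul_le_mul_of_nonneg_right h1.le (hD (n + 1))
    have := mul_le_mul_of_nonneg_right h2.le (hD n)
    linarith [h n]
  refine (summable_nat_add_iff 1).mp (.of_nonneg_of_le (fun n => hD _) (fun n => ?_) hY)
  have := mul_nonneg hμ0.le (hD n)
  linarith

/-- The sum of the norms of all contributions to the term of order `N`. -/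
noncomputable def levelNorm (ρ α : ℝ) (s : ℂ) (N : ℕ) : ℝ :=
  ∑ k ∈ Finset.range (N + 1), ‖levelCoeff ρ α s k N‖

lemma levelNorm_eq (ρ α : ℝ) (s : ℂ) {N K : ℕ} (hK : N < K) :
    ∑ k ∈ Finset.range K, ‖levelCoeff ρ α s k N‖ = levelNorm ρ α s N := by
  refine (Finset.sum_subset (Finset.range_subset_range.mpr hK) fun k _ hk => ?_).symm
  rw [Finset.mem_range] at hk
  rw [levelCoeff_of_lt (by omega), norm_zero]

/-- The triangle inequality in the level recurrences, summed over `k`. Rearranging the double series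
needs the norms of the separate levels; bounds on `coeff` alone would not do. -/
lemma levelNorm_le (ρ α : ℝ) (s : ℂ) (N : ℕ) :
    ((N : ℝ) + 2) * (N + 3 / 2) * levelNorm ρ α s (N + 2) ≤
      (1 + ρ ^ 2) * ‖((N : ℂ) + 1) ^ 2 - s ^ 2‖ * levelNorm ρ α s (N + 1) +
        ρ ^ 2 * |(N - α / 2) * (N + 1 / 2 + α / 2)| * levelNorm ρ α s N := by
  have hden : ‖((N : ℂ) + 2) * (N + 3 / 2)‖ = ((N : ℝ) + 2) * (N + 3 / 2) := by
    have : ((N : ℂ) + 2) * (N + 3 / 2) = (((N : ℝ) + 2) * (N + 3 / 2) : ℝ) := by push_cast; ring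
    rw [this, Complex.norm_real, Real.norm_of_nonneg (by positivity)]
  have hA : ‖(1 + (ρ : ℂ) ^ 2)‖ = 1 + ρ ^ 2 := by
    have : 1 + (ρ : ℂ) ^ 2 = ((1 + ρ ^ 2 : ℝ) : ℂ) := by push_cast; ring
    rw [this, Complex.norm_real, Real.norm_of_nonneg (by positivity)]
  have hB : ‖(-(ρ : ℂ) ^ 2) * ((N - α / 2) * (N + 1 / 2 + α / 2))‖
      = ρ ^ 2 * |(N - α / 2) * (N + 1 / 2 + α / 2)| := by
    have : (-(ρ : ℂ) ^ 2) * ((N - α / 2) * (N + 1 / 2 + α / 2))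
      = ((-ρ ^ 2 * ((N - α / 2) * (N + 1 / 2 + α / 2)) : ℝ) : ℂ) := by push_cast; ring
    rw [this, Complex.norm_real, Real.norm_eq_abs, abs_mul, abs_neg, abs_of_nonneg (sq_nonneg ρ)]
  have h0 : ((N : ℝ) + 2) * (N + 3 / 2) * ‖levelCoeff ρ α s 0 (N + 2)‖
      = (1 + ρ ^ 2) * ‖((N : ℂ) + 1) ^ 2 - s ^ 2‖ * ‖levelCoeff ρ α s 0 (N + 1)‖ := by
    rw [← hden, ← norm_mul, levelCoeff_zero_recurrence, norm_mul, norm_mul, hA]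
  have hk : ∀ k ∈ Finset.range (N + 2),
      ((N : ℝ) + 2) * (N + 3 / 2) * ‖levelCoeff ρ α s (k + 1) (N + 2)‖ ≤
        (1 + ρ ^ 2) * ‖((N : ℂ) + 1) ^ 2 - s ^ 2‖ * ‖levelCoeff ρ α s (k + 1) (N + 1)‖ +
          ρ ^ 2 * |(N - α / 2) * (N + 1 / 2 + α / 2)| * ‖levelCoeff ρ α s k N‖ := fun k _ => by
    rw [← hden, ← norm_mul, levelCoeff_succ_recurrence]
    refine (norm_add_le _ _).trans (le_of_eq ?_)
    rw [norm_mul, norm_mul _ (levelCoeff ρ α s k N), norm_mul, hA, hB]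
  have hsum := Finset.sum_le_sum hk
  rw [Finset.sum_add_distrib, ← Finset.mul_sum, ← Finset.mul_sum, ← Finset.mul_sum] at hsum
  rw [← levelNorm_eq ρ α s (show N + 1 < N + 2 + 1 by omega),
    ← levelNorm_eq ρ α s (show N < N + 2 by omega), levelNorm, Finset.sum_range_succ',
    Finset.sum_range_succ' _ (N + 2)]
  linear_combination hsum + h0

lemma summable_levelNorm {ρ α h r : ℝ} (hr : 0 ≤ r)
    (hr1 : (1 + ρ ^ 2) * r + ρ ^ 2 * r ^ 2 < 1) :
    Summable fun N => levelNorm ρ α (sigma ρ h) N * r ^ N := by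
  set σ : ℝ := h / (4 * (1 + ρ ^ 2)) with hσ
  have hP := (tendsto_quadratic_div ((1 + ρ ^ 2) * r) (2 * ((1 + ρ ^ 2) * r))
    ((1 + ρ ^ 2) * r * (1 - σ))).abs
  have hQ := (tendsto_quadratic_div (ρ ^ 2 * r ^ 2) (ρ ^ 2 * r ^ 2 / 2)
    (-(ρ ^ 2 * r ^ 2 * ((α / 2) * (1 / 2 + α / 2))))).abs
  have hD0 : ∀ N, 0 ≤ levelNorm ρ α (sigma ρ h) N := fun N =>
    Finset.sum_nonneg fun _ _ => norm_nonneg _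
  refine summable_of_two_term_bound (fun N => mul_nonneg (hD0 N) (by positivity)) hP hQ
    (abs_nonneg _) ?_ fun N => ?_
  · rwa [abs_of_nonneg (by positivity), abs_of_nonneg (by positivity)]
  · have hden : 0 < ((N : ℝ) + 2) * (N + 3 / 2) := by positivity
    have hnorm : ‖((N : ℂ) + 1) ^ 2 - sigma ρ h ^ 2‖ = |((N : ℝ) + 1) ^ 2 - σ| := by
      rw [sigma_sq, ← hσ, ← Real.norm_eq_abs, ← Complex.norm_real]
      push_cast
      rfl
    have hA : (0 : ℝ) ≤ (1 + ρ ^ 2) * r := by positivity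
    have hB : (0 : ℝ) ≤ ρ ^ 2 * r ^ 2 := by positivity
    have e1 : (1 + ρ ^ 2) * r * (N : ℝ) ^ 2 + 2 * ((1 + ρ ^ 2) * r) * N + (1 + ρ ^ 2) * r * (1 - σ)
        = (1 + ρ ^ 2) * r * (((N : ℝ) + 1) ^ 2 - σ) := by ring
    have e2 : ρ ^ 2 * r ^ 2 * (N : ℝ) ^ 2 + ρ ^ 2 * r ^ 2 / 2 * N
          + -(ρ ^ 2 * r ^ 2 * ((α / 2) * (1 / 2 + α / 2)))
        = ρ ^ 2 * r ^ 2 * ((N - α / 2) * (N + 1 / 2 + α / 2)) := by ring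
    have h1 := mul_le_mul_of_nonneg_right (levelNorm_le ρ α (sigma ρ h) N)
      (by positivity : 0 ≤ r ^ (N + 2))
    rw [e1, e2, abs_div, abs_div, abs_of_pos hden, abs_mul, abs_mul (ρ ^ 2 * r ^ 2),
      abs_of_nonneg hA, abs_of_nonneg hB, div_mul_eq_mul_div, div_mul_eq_mul_div, ← add_div,
      le_div_iff₀ hden]
    rw [hnorm] at h1
    refine le_trans (le_of_eq ?_) (h1.trans (le_of_eq ?_)) <;> ring

lemma hasSum_levelCoeff (ρ α : ℝ) (s : ℂ) (k : ℕ) {ξ : ℂ} (hξ : ‖(1 + (ρ : ℂ) ^ 2) * ξ‖ < 1) :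
    HasSum (fun N => levelCoeff ρ α s k N * ξ ^ N)
      (psum (nestCoeff α s k) ((1 + (ρ : ℂ) ^ 2) * ξ) * (-(ρ : ℂ) ^ 2 * ξ ^ 2) ^ k) := by
  rw [← hasSum_nat_add_iff' (2 * k), Finset.sum_eq_zero, sub_zero]
  · refine (((conv_nestCoeff α s k).hasSum hξ).mul_right _).congr_fun fun n => ?_
    rw [levelCoeff_add, mul_pow, mul_pow]
    ring
  · intro N hN
    rw [levelCoeff_of_lt (Finset.mem_range.mp hN), zero_mul]

/-- One absolutely convergent double series, summed in two orders: first over `k` it is the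
Frobenius series, first over `N` it is the expansion in powers of `z`. -/
lemma hasSum_levels {ρ α h : ℝ} {ξ : ℂ} (hξ : (1 + ρ ^ 2) * ‖ξ‖ + ρ ^ 2 * ‖ξ‖ ^ 2 < 1) :
    HasSum (fun k : ℕ => psum (nestCoeff α (sigma ρ h) k) ((1 + (ρ : ℂ) ^ 2) * ξ) *
      (-(ρ : ℂ) ^ 2 * ξ ^ 2) ^ k) (LF ρ α h ξ) := by
  have hη : ‖(1 + (ρ : ℂ) ^ 2) * ξ‖ < 1 := by
    have : 1 + (ρ : ℂ) ^ 2 = ((1 + ρ ^ 2 : ℝ) : ℂ) := by push_cast; ring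
    rw [norm_mul, this, Complex.norm_real, Real.norm_of_nonneg (by positivity)]
    have : 0 ≤ ρ ^ 2 * ‖ξ‖ ^ 2 := by positivity
    linarith
  set f : ℕ × ℕ → ℂ := fun i => levelCoeff ρ α (sigma ρ h) i.2 i.1 * ξ ^ i.1 with hf
  have hzero : ∀ N, ∀ k ∉ Finset.range (N + 1), levelCoeff ρ α (sigma ρ h) k N = 0 := by
    intro N k hk
    rw [Finset.mem_range] at hk
    exact levelCoeff_of_lt (by omega)
  have hsum : Summable f := by
    refine Summable.of_norm ((summable_prod_of_nonneg fun _ => norm_nonneg _).mpr ⟨fun N => ?_, ?_⟩)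
    · refine summable_of_ne_finset_zero (s := Finset.range (N + 1)) fun k hk => ?_
      simp [hf, hzero N k hk]
    · refine (summable_levelNorm (ρ := ρ) (α := α) (h := h) (norm_nonneg ξ) hξ).congr fun N => ?_
      rw [tsum_eq_sum (s := Finset.range (N + 1)) fun k hk => by simp [hf, hzero N k hk]]
      simp [hf, levelNorm, Finset.sum_mul]
  have h1 : HasSum (fun N => (coeff ρ α h N : ℂ) * ξ ^ N) (∑' i, f i) := by
    refine hsum.hasSum.prod_fiberwise fun N => ?_
    rw [← sum_levelCoeff ρ α h N (N + 1) N.lt_succ_self, Finset.sum_mul]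
    exact hasSum_sum_of_ne_finset_zero fun k hk => by simp [hf, hzero N k hk]
  have h2 := ((Equiv.prodComm ℕ ℕ).hasSum_iff.mpr hsum.hasSum).prod_fiberwise
    fun k => hasSum_levelCoeff ρ α (sigma ρ h) k hη
  rw [LF, h1.tsum_eq]
  exact h2

end Lame

theorem mainTheorem7 (ρ α h : ℝ) (hρ₀ : 0 < ρ) (hρ₁ : ρ < 1) :
    -- `LF` is the solution of the Lamé equation that is analytic at `0` with value `1` there
    (DifferentiableOn ℂ (Lame.LF ρ α h) (Metric.ball 0 1) ∧ Lame.LF ρ α h 0 = 1 ∧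
      ∀ ξ ∈ Metric.ball (0 : ℂ) 1, ξ ≠ 0 → Lame.EquationAt ρ α h (Lame.LF ρ α h) ξ) ∧
    -- admissible contours exist
    (∃ r, Lame.AdmissibleRadii r) ∧
    ∀ r, Lame.AdmissibleRadii r →
      -- the derivatives and integrals in the representation exist
      (∀ n : ℕ, DifferentiableOn ℂ (Lame.nestedIntegral ρ α h r n) (Metric.ball 0 1 \ {0})) ∧
      (∀ (n : ℕ) (x : ℂ), 0 < ‖x‖ → ‖x‖ < 1 →
        (∀ t ∈ Set.Ioo (0 : ℝ) 1, ∀ u ∈ Set.Ioo (0 : ℝ) 1,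
          CircleIntegrable
            (Lame.contourIntegrand ρ α h (n + 1) (Lame.nestedIntegral ρ α h r n) x t u)
            0 (r (n + 1) x t u)) ∧
        (∀ t ∈ Set.Ioo (0 : ℝ) 1,
          IntervalIntegrable
            (Lame.uIntegrand ρ α h (n + 1) (r (n + 1)) (Lame.nestedIntegral ρ α h r n) x t)
            MeasureTheory.volume 0 1) ∧
        IntervalIntegrable
          (Lame.tIntegrand ρ α h (n + 1) (r (n + 1)) (Lame.nestedIntegral ρ α h r n) x)
          MeasureTheory.volume 0 1) ∧
      -- the representation, with `η = (1 + ρ²) ξ` and `z = -ρ² ξ²`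
      ∀ ξ : ℂ, (1 + ρ ^ 2) * ‖ξ‖ + ρ ^ 2 * ‖ξ‖ ^ 2 < 1 →
        HasSum
          (fun n : ℕ => Lame.nestedIntegral ρ α h r (n + 1) ((1 + (ρ : ℂ) ^ 2) * ξ)
            * (-(ρ : ℂ) ^ 2 * ξ ^ 2) ^ (n + 1))
          (Lame.LF ρ α h ξ
            - ordinaryHypergeometric (Lame.deltaMinus ρ h 0) (Lame.deltaPlus ρ h 0) (1 / 2 : ℂ)
                ((1 + (ρ : ℂ) ^ 2) * ξ)) := by
  have hc := Lame.conv_coeff (α := α) (h := h) hρ₀ hρ₁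
  refine ⟨⟨Lame.psum_differentiableOn hc, ?_, fun ξ hξ h0 =>
    Lame.LF_equationAt hρ₀ hρ₁ hc (by simpa using hξ) h0⟩, Lame.exists_admissibleRadii,
    fun r hr => ⟨fun n => ?_, fun n x hx0 hx => ?_, fun ξ hξ => ?_⟩⟩
  · rw [Lame.LF, tsum_eq_single 0 fun n hn => by simp [hn]]
    simp [Lame.coeff]
  · refine ((Lame.psum_differentiableOn (Lame.conv_nestCoeff α (Lame.sigma ρ h) n)).mono
      Set.sdiff_subset).congr fun x hx => ?_
    exact Lame.nestedIntegral_eq_psum hr n x (norm_pos_iff.mpr hx.2) (by simpa using hx.1)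
  · obtain ⟨h1, h2, h3, -⟩ := Lame.level_step (ρ := ρ) (h := h) (κ := n)
      (Lame.conv_nestCoeff α _ n) (Lame.nestedIntegral_eq_psum hr n) hx0 hx
      fun t u ht hu => hr (n + 1) x t u hx ht hu
    exact ⟨h1, h2, h3⟩
  · have h0 : ordinaryHypergeometric (Lame.deltaMinus ρ h 0) (Lame.deltaPlus ρ h 0) (1 / 2 : ℂ)
        ((1 + (ρ : ℂ) ^ 2) * ξ)
        = Lame.psum (Lame.nestCoeff α (Lame.sigma ρ h) 0) ((1 + (ρ : ℂ) ^ 2) * ξ) := by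
      rw [← Lame.hypergeometric_eq_psum, Lame.deltaMinus, Lame.deltaPlus]
      simp
    have hs := (hasSum_nat_add_iff' 1).mpr (Lame.hasSum_levels (α := α) (h := h) hξ)
    rw [Finset.sum_range_one, pow_zero, mul_one, ← h0] at hs
    refine hs.congr_fun fun n => ?_
    -- The power series of the nested integral is available only off `0`; at `ξ = 0` the factor `z ^
    -- (n + 1)` vanishes and its value is irrelevant.
    by_cases hξ0 : ξ = 0
    · simp [hξ0]
    · have hA : (1 + ρ ^ 2 : ℝ) ≠ 0 := by positivity
      have hA' : (1 + (ρ : ℂ) ^ 2) ≠ 0 := by exact_mod_cast hA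
      rw [Lame.nestedIntegral_eq_psum hr (n + 1) _ (norm_pos_iff.mpr (mul_ne_zero hA' hξ0))]
      have : 1 + (ρ : ℂ) ^ 2 = ((1 + ρ ^ 2 : ℝ) : ℂ) := by push_cast; ring
      rw [norm_mul, this, Complex.norm_real, Real.norm_of_nonneg (by positivity)]
      have : 0 ≤ ρ ^ 2 * ‖ξ‖ ^ 2 := by positivity
      linarith
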